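/- Let $\omega:[0,\infty)\to[0,\infty)$ be a non-quasianalytic subadditive weight function, i.e. a continuous increasing function such that $\omega(s+t)\le\omega(s)+\omega(t)$ for all $s,t\ge 0$, $\int_1^\infty \omega(t)t^{-2}\,dt<\infty$, $\log t=o(\omega(t))$ as $t\to\infty$, and $t\mapsto\omega(e^t)$ is convex; for a vector $\zeta$ write $\omega(\zeta):=\omega(|\zeta|)$, with $|\cdot|$ the Euclidean norm. Let $\mathcal S_\omega(\mathbb R^d)$ be the space of all Schwartz functions $f$ on $\mathbb R^d$ such that, for all $\lambda>0$ and all multi-indices $\alpha$, $\sup_x e^{\lambda\omega(x)}|\partial^\alpha f(x)|<\infty$ and $\sup_\xi e^{\lambda\omega(\xi)}|\partial^\alpha\widehat f(\xi)|<\infty$, where $\widehat f(\xi)=\int e^{-i\langle x,\xi\rangle}f(x)\,dx$, with the topology given by these seminorms, and let $\mathcal S_\omega'(\mathbb R^d)$ be the space of continuous linear functionals on $\mathcal S_\omega(\mathbb R^d)$. For $u\in\mathcal S'_\omega(\mathbb R^d)$, $\varphi\in\mathcal S_\omega(\mathbb R^d)\setminus\{0\}$ and $z=(x,\xi)\in\mathbb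 R^{2d}$ let $$V_\varphi u(z)=\langle u,\Pi(z)\varphi\rangle,\qquad (\Pi(z)\varphi)(y)=e^{i\langle y,\xi\rangle}\varphi(y-x),$$ where $\langle u,f\rangle:=u(\overline f)$ is the conjugate linear action of $u$ on $\mathcal S_\omega(\mathbb R^d)$. An open conic set is an open set $\Gamma\subseteq\mathbb R^{2d}\setminus\{0\}$ such that $tz\in\Gamma$ for all $z\in\Gamma$, $t>0$. Let $S$ be the unit sphere of $\mathbb R^{2d}$. **Proposition.** Let $u\in\mathcal S'_\omega(\mathbb R^d)$, $\varphi\in\mathcal S_\omega(\mathbb R^d)\setminus\{0\}$, and let $\Gamma\subseteq\mathbb R^{2d}\setminus\{0\}$ be an open conic set such that $$\sup_{z\in\Gamma}e^{\lambda\omega(z)}|V_\varphi u(z)|<\infty\qquad\text{for all }\lambda>0 .$$ Then, for every $\psi\in\mathcal S_\omega(\mathbb R^d)\setminus\{0\}$ and every open conic set $\Gamma'\subseteq\mathbb R^{2d}\setminus\{0\}$ with $\overline{\Gamma'\cap S}\subseteq\Gamma$, $$\sup_{z\in\Gamma'}e^{\lambda\omega(z)}|V_\psi u(z)|<\infty\qquad\text{for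 all }\lambda>0 .$$ Consequently the $\omega$-wave front set $\mathrm{WF}'_\omega(u)$ does not depend on the window: the set of all $z_0\in\mathbb R^{2d}\setminus\{0\}$ for which there is no open conic set $\Gamma\subseteq\mathbb R^{2d}\setminus\{0\}$ containing $z_0$ with $\sup_{z\in\Gamma}e^{\lambda\omega(z)}|V_\varphi u(z)|<\infty$ for all $\lambda>0$ is the same for all $\varphi\in\mathcal S_\omega(\mathbb R^d)\setminus\{0\}$. -/

import Mathlib

open MeasureTheory Set
open scoped SchwartzMap FourierTransform

noncomputable section

namespace OmegaGabor

/-- A non-quasianalytic subadditive weight function `ω : [0, ∞) → [0, ∞)`. It is represented by a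
function on `ℝ` of which only the values on `[0, ∞)` matter. -/
structure WeightFunction where
  toFun : ℝ → ℝ
  continuousOn' : ContinuousOn toFun (Ici 0)
  monotoneOn' : MonotoneOn toFun (Ici 0)
  nonneg' : ∀ t, 0 ≤ t → 0 ≤ toFun t
  subadditive' : ∀ s t, 0 ≤ s → 0 ≤ t → toFun (s + t) ≤ toFun s + toFun t
  nonquasianalytic' : IntegrableOn (fun t => toFun t / t ^ 2) (Ici 1)
  log_isLittleO' : Real.log =o[Filter.atTop] toFun
  convex' : ConvexOn ℝ univ (fun t => toFun (Real.exp t))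

instance : CoeFun WeightFunction (fun _ => ℝ → ℝ) := ⟨WeightFunction.toFun⟩

/-- The Euclidean space `ℝ^d`. -/
abbrev Space (d : ℕ) : Type := EuclideanSpace ℝ (Fin d)

/-- The phase space `ℝ^{2d}` of pairs `z = (x, ξ)`, with the Euclidean norm. -/
abbrev PhaseSpace (d : ℕ) : Type := WithLp 2 (Space d × Space d)

variable {d : ℕ}

/-- The Fourier transform `∫ e^{-i⟨x, ξ⟩} f(x) dx`. -/
def fourierInt (f : Space d → ℂ) (ξ : Space d) : ℂ :=
  ∫ x, Complex.exp (-(Complex.I * (inner ℝ x ξ : ℝ))) * f x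

/-- `sup_x e^{lam ω(x)} |D^n g(x)| < ∞` for all `lam > 0` and all orders `n`, where `D^n g(x)` is
the full `n`-th derivative: its norm is finite-dimensionally equivalent to the maximum of the
partial derivatives of order `n`. -/
def HasOmegaDecay (ω : WeightFunction) (g : Space d → ℂ) : Prop :=
  ∀ lam : ℝ, 0 < lam → ∀ n : ℕ,
    BddAbove (range fun x => Real.exp (lam * ω ‖x‖) * ‖iteratedFDeriv ℝ n g x‖)

/-- The oscillation `y ↦ e^{i⟨y, ξ⟩}`. -/
def character (ξ : Space d) (y : Space d) : ℂ := Complex.exp (Complex.I * (inner ℝ y ξ : ℝ))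

/-! Helper facts: stability of the decay conditions. -/

theorem fourierInt_eq (f : Space d → ℂ) (ξ : Space d) :
    fourierInt f ξ = 𝓕 f ((2 * Real.pi)⁻¹ • ξ) := by
  rw [Real.fourier_eq', fourierInt]
  congr 1
  ext x
  rw [smul_eq_mul, inner_smul_right]
  congr 2
  have : (Real.pi : ℂ) ≠ 0 := by exact_mod_cast Real.pi_ne_zero
  push_cast
  field_simp

theorem contDiff_fourierInt (f : 𝓢(Space d, ℂ)) : ContDiff ℝ (⊤ : ℕ∞) (fourierInt (f : Space d → ℂ)) := by
  have h : fourierInt (f : Space d → ℂ) =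
      (𝓕 f : 𝓢(Space d, ℂ)) ∘ (fun ξ : Space d => (2 * Real.pi)⁻¹ • ξ) := by
    ext ξ
    rw [fourierInt_eq, Function.comp, SchwartzMap.fourier_coe]
  rw [h]
  exact ((𝓕 f).smooth ⊤).comp (contDiff_const_smul _)

theorem contDiff_character (ξ : Space d) : ContDiff ℝ (⊤ : ℕ∞) (character ξ) := by
  have h2 : ContDiff ℝ (⊤ : ℕ∞) (fun y : Space d => ((inner ℝ y ξ : ℝ) : ℂ)) :=
    Complex.ofRealCLM.contDiff.comp (contDiff_id.inner ℝ contDiff_const)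
  exact (contDiff_const.mul h2).cexp

theorem norm_iteratedFDeriv_character_le (ξ : Space d) (n : ℕ) (y : Space d) :
    ‖iteratedFDeriv ℝ n (character ξ) y‖ ≤ ‖ξ‖ ^ n := by
  let g : ℝ → ℂ := fun t => Complex.exp (Complex.I * t)
  have hg : ∀ m : ℕ, iteratedDeriv m g = fun t : ℝ => Complex.I ^ m * Complex.exp (Complex.I * t) := by
    intro m
    induction m with
    | zero => simp [g]
    | succ k ih =>
      rw [iteratedDeriv_succ, ih]
      ext t
      have h1 : HasDerivAt (fun t : ℝ => Complex.I * (t : ℂ)) (Complex.I * 1) t :=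
        (Complex.ofRealCLM.hasDerivAt (x := t)).const_mul Complex.I
      rw [(h1.cexp.const_mul (Complex.I ^ k)).deriv]
      ring
  have hgs : ContDiff ℝ (⊤ : ℕ∞) g := (contDiff_const.mul Complex.ofRealCLM.contDiff).cexp
  have hc : character ξ = g ∘ (innerSL ℝ ξ) := by
    ext y
    simp [character, g, real_inner_comm]
  rw [hc, ContinuousLinearMap.iteratedFDeriv_comp_right (innerSL ℝ ξ) hgs y (i := n)
    (by exact_mod_cast le_top)]
  refine (ContinuousMultilinearMap.norm_compContinuousLinearMap_le _ _).trans ?_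
  rw [norm_iteratedFDeriv_eq_norm_iteratedDeriv, hg]
  simp [Complex.norm_exp]

theorem hasTemperateGrowth_character (ξ : Space d) :
    Function.HasTemperateGrowth (character ξ) :=
  ⟨contDiff_character ξ, fun n => ⟨0, ‖ξ‖ ^ n, fun x => by
    simpa using norm_iteratedFDeriv_character_le ξ n x⟩⟩

variable {ω : WeightFunction}

theorem HasOmegaDecay.zero : HasOmegaDecay ω (0 : Space d → ℂ) := by
  intro lam _ n
  refine ⟨0, ?_⟩
  rintro _ ⟨x, rfl⟩
  simp

theorem HasOmegaDecay.add {f g : Space d → ℂ} (hf : HasOmegaDecay ω f) (hg : HasOmegaDecay ω g)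
    (hfs : ContDiff ℝ (⊤ : ℕ∞) f) (hgs : ContDiff ℝ (⊤ : ℕ∞) g) : HasOmegaDecay ω (f + g) := by
  intro lam hl n
  obtain ⟨A, hA⟩ := hf lam hl n
  obtain ⟨B, hB⟩ := hg lam hl n
  refine ⟨A + B, ?_⟩
  rintro _ ⟨x, rfl⟩
  have h1 := hA ⟨x, rfl⟩
  have h2 := hB ⟨x, rfl⟩
  dsimp only at h1 h2 ⊢
  rw [iteratedFDeriv_add_apply (hfs.of_le (by exact_mod_cast le_top)).contDiffAt
    (hgs.of_le (by exact_mod_cast le_top)).contDiffAt]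
  calc _ ≤ Real.exp (lam * ω ‖x‖) * (‖iteratedFDeriv ℝ n f x‖ + ‖iteratedFDeriv ℝ n g x‖) := by
        gcongr
        exact norm_add_le _ _
    _ ≤ A + B := by linarith

theorem HasOmegaDecay.const_smul {f : Space d → ℂ} (hf : HasOmegaDecay ω f)
    (hfs : ContDiff ℝ (⊤ : ℕ∞) f) (c : ℂ) : HasOmegaDecay ω (c • f) := by
  intro lam hl n
  obtain ⟨A, hA⟩ := hf lam hl n
  refine ⟨‖c‖ * A, ?_⟩
  rintro _ ⟨x, rfl⟩
  have h1 := hA ⟨x, rfl⟩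
  dsimp only at h1 ⊢
  rw [iteratedFDeriv_const_smul_apply (hfs.of_le (by exact_mod_cast le_top)).contDiffAt, norm_smul]
  calc _ = ‖c‖ * (Real.exp (lam * ω ‖x‖) * ‖iteratedFDeriv ℝ n f x‖) := by ring
    _ ≤ ‖c‖ * A := by gcongr

theorem HasOmegaDecay.conj {f : Space d → ℂ} (hf : HasOmegaDecay ω f) :
    HasOmegaDecay ω (fun x => (starRingEnd ℂ) (f x)) := by
  intro lam hl n
  have h : ∀ x, ‖iteratedFDeriv ℝ n (fun x => (starRingEnd ℂ) (f x)) x‖ =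
      ‖iteratedFDeriv ℝ n f x‖ := fun x =>
    LinearIsometryEquiv.norm_iteratedFDeriv_comp_left Complex.conjLIE f x n
  simpa only [h] using hf lam hl n

theorem HasOmegaDecay.comp_neg {f : Space d → ℂ} (hf : HasOmegaDecay ω f) :
    HasOmegaDecay ω (fun x => f (-x)) := by
  intro lam hl n
  obtain ⟨A, hA⟩ := hf lam hl n
  refine ⟨A, ?_⟩
  rintro _ ⟨x, rfl⟩
  have h := LinearIsometryEquiv.norm_iteratedFDeriv_comp_right
    (LinearIsometryEquiv.neg ℝ (E := Space d)) f x n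
  have h1 := hA ⟨-x, rfl⟩
  dsimp only at h1 ⊢
  rw [norm_neg] at h1
  have h2 : (f ∘ (LinearIsometryEquiv.neg ℝ (E := Space d))) = fun x => f (-x) := rfl
  rw [h2] at h
  rw [h]
  exact h1

theorem HasOmegaDecay.comp_sub {f : Space d → ℂ} (hf : HasOmegaDecay ω f) (a : Space d) :
    HasOmegaDecay ω (fun x => f (x - a)) := by
  intro lam hl n
  obtain ⟨A, hA⟩ := hf lam hl n
  refine ⟨Real.exp (lam * ω ‖a‖) * A, ?_⟩
  rintro _ ⟨x, rfl⟩
  have h1 := hA ⟨x - a, rfl⟩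
  dsimp only at h1 ⊢
  rw [iteratedFDeriv_comp_sub]
  have h2 : ω ‖x‖ ≤ ω ‖a‖ + ω ‖x - a‖ := by
    refine le_trans (ω.monotoneOn' (norm_nonneg x)
      (add_nonneg (norm_nonneg a) (norm_nonneg (x - a))) ?_)
      (ω.subadditive' _ _ (norm_nonneg _) (norm_nonneg _))
    simpa using norm_add_le a (x - a)
  calc _ ≤ Real.exp (lam * (ω ‖a‖ + ω ‖x - a‖)) * ‖iteratedFDeriv ℝ n f (x - a)‖ := by gcongr
    _ = Real.exp (lam * ω ‖a‖) *
        (Real.exp (lam * ω ‖x - a‖) * ‖iteratedFDeriv ℝ n f (x - a)‖) := by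
      rw [mul_add, Real.exp_add]; ring
    _ ≤ _ := by gcongr

theorem HasOmegaDecay.character_mul {f : Space d → ℂ} (hf : HasOmegaDecay ω f)
    (hfs : ContDiff ℝ (⊤ : ℕ∞) f) (ξ : Space d) : HasOmegaDecay ω (fun x => character ξ x * f x) := by
  intro lam hl n
  choose A hA using fun k => hf lam hl k
  refine ⟨∑ i ∈ Finset.range (n + 1), (n.choose i : ℝ) * ‖ξ‖ ^ i * A (n - i), ?_⟩
  rintro _ ⟨x, rfl⟩
  dsimp only
  have h := norm_iteratedFDeriv_mul_le (contDiff_character ξ) hfs x (n := n)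
    (by exact_mod_cast le_top)
  refine (mul_le_mul_of_nonneg_left h (Real.exp_pos _).le).trans ?_
  rw [Finset.mul_sum]
  refine Finset.sum_le_sum fun i _ => ?_
  have h1 := hA (n - i) ⟨x, rfl⟩
  dsimp only at h1
  calc _ = (n.choose i : ℝ) * ‖iteratedFDeriv ℝ i (character ξ) x‖ *
        (Real.exp (lam * ω ‖x‖) * ‖iteratedFDeriv ℝ (n - i) f x‖) := by ring
    _ ≤ (n.choose i : ℝ) * ‖ξ‖ ^ i * A (n - i) := by
      gcongr
      exact norm_iteratedFDeriv_character_le ξ i x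

theorem integrable_fourierInt (f : 𝓢(Space d, ℂ)) (ξ : Space d) :
    Integrable (fun x => Complex.exp (-(Complex.I * (inner ℝ x ξ : ℝ))) * f x) := by
  refine f.integrable.mono ?_ ?_
  · refine Continuous.aestronglyMeasurable ?_
    have := f.continuous
    fun_prop
  · refine Filter.Eventually.of_forall fun x => ?_
    simp [Complex.norm_exp]

theorem fourierInt_add (f g : 𝓢(Space d, ℂ)) :
    fourierInt ((f + g : 𝓢(Space d, ℂ)) : Space d → ℂ) = fourierInt f + fourierInt g := by
  ext ξ
  rw [Pi.add_apply, fourierInt, fourierInt, fourierInt, ← integral_add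
    (integrable_fourierInt f ξ) (integrable_fourierInt g ξ)]
  simp [mul_add]

theorem fourierInt_smul (c : ℂ) (f : 𝓢(Space d, ℂ)) :
    fourierInt ((c • f : 𝓢(Space d, ℂ)) : Space d → ℂ) = c • fourierInt f := by
  ext ξ
  rw [Pi.smul_apply, fourierInt, fourierInt, smul_eq_mul, ← integral_const_mul]
  congr 1
  ext x
  simp only [smul_apply, smul_eq_mul]
  ring

theorem fourierInt_conj (f : Space d → ℂ) :
    fourierInt (fun x => (starRingEnd ℂ) (f x)) =
      fun ξ => (starRingEnd ℂ) (fourierInt f (-ξ)) := by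
  ext ξ
  rw [fourierInt, fourierInt, ← integral_conj]
  congr 1
  ext x
  simp [← Complex.exp_conj]

theorem fourierInt_shift (f : Space d → ℂ) (x ξ : Space d) :
    fourierInt (fun y => character ξ y * f (y - x)) =
      (Complex.exp (Complex.I * (inner ℝ x ξ : ℝ))) •
        fun η => character (-x) η * fourierInt f (η - ξ) := by
  ext η
  rw [Pi.smul_apply, smul_eq_mul, fourierInt, fourierInt, ← integral_const_mul,
    ← integral_const_mul, ← integral_add_right_eq_self _ x]
  congr 1
  ext y
  rw [add_sub_cancel_right, character, character, ← mul_assoc, ← mul_assoc, ← mul_assoc,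
    ← Complex.exp_add, ← Complex.exp_add, ← Complex.exp_add]
  congr 2
  simp only [inner_add_left, inner_sub_right, inner_neg_right, real_inner_comm]
  push_cast
  ring

/-! The space `S_ω(ℝ^d)` and its dual. -/

/-- The subspace of the Schwartz functions `f` such that `f` and its Fourier transform satisfy the
exponential decay conditions. -/
def omegaSubmodule (ω : WeightFunction) (d : ℕ) : Submodule ℂ 𝓢(Space d, ℂ) where
  carrier := {f | HasOmegaDecay ω (f : Space d → ℂ) ∧
    HasOmegaDecay ω (fourierInt (f : Space d → ℂ))}
  zero_mem' := by
    refine ⟨HasOmegaDecay.zero, ?_⟩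
    have : fourierInt ((0 : 𝓢(Space d, ℂ)) : Space d → ℂ) = 0 := by
      ext ξ; simp [fourierInt]
    rw [this]
    exact HasOmegaDecay.zero
  add_mem' := by
    intro f g hf hg
    refine ⟨hf.1.add hg.1 (f.smooth ⊤) (g.smooth ⊤), ?_⟩
    rw [fourierInt_add]
    exact hf.2.add hg.2 (contDiff_fourierInt f) (contDiff_fourierInt g)
  smul_mem' := by
    intro c f hf
    refine ⟨hf.1.const_smul (f.smooth ⊤) c, ?_⟩
    rw [fourierInt_smul]
    exact hf.2.const_smul (contDiff_fourierInt f) c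

/-- The space `S_ω(ℝ^d)`. It is a type of its own, since its topology is finer than the one induced
by the Schwartz space. -/
def OmegaSchwartz (ω : WeightFunction) (d : ℕ) : Type := omegaSubmodule ω d

instance : AddCommGroup (OmegaSchwartz ω d) := inferInstanceAs (AddCommGroup (omegaSubmodule ω d))

instance : Module ℂ (OmegaSchwartz ω d) := inferInstanceAs (Module ℂ (omegaSubmodule ω d))

/-- The inclusion of `S_ω(ℝ^d)` in the Schwartz space. -/
def OmegaSchwartz.toSchwartz : OmegaSchwartz ω d →ₗ[ℂ] 𝓢(Space d, ℂ) := (omegaSubmodule ω d).subtype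

theorem OmegaSchwartz.hasOmegaDecay (f : OmegaSchwartz ω d) :
    HasOmegaDecay ω (f.toSchwartz : Space d → ℂ) := f.2.1

theorem OmegaSchwartz.hasOmegaDecay_fourierInt (f : OmegaSchwartz ω d) :
    HasOmegaDecay ω (fourierInt (f.toSchwartz : Space d → ℂ)) := f.2.2

/-- The seminorm `sup_x e^{lam ω(x)} |D^n f(x)|`. -/
def seminormSpace (ω : WeightFunction) (d : ℕ) (p : Ioi (0 : ℝ) × ℕ) :
    Seminorm ℂ (OmegaSchwartz ω d) :=
  Seminorm.of
    (fun f => ⨆ x, Real.exp (p.1 * ω ‖x‖) *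
      ‖iteratedFDeriv ℝ p.2 (f.toSchwartz : Space d → ℂ) x‖)
    (by
      intro f g
      refine ciSup_le fun x => ?_
      have h1 := le_ciSup (f.hasOmegaDecay p.1 p.1.2 p.2) x
      have h2 := le_ciSup (g.hasOmegaDecay p.1 p.1.2 p.2) x
      refine le_trans ?_ (add_le_add h1 h2)
      have h3 : ((f + g).toSchwartz : Space d → ℂ) = f.toSchwartz + g.toSchwartz := by
        rw [map_add]; rfl
      rw [h3, iteratedFDeriv_add_apply ((f.toSchwartz.smooth ⊤).of_le
        (by exact_mod_cast le_top)).contDiffAt ((g.toSchwartz.smooth ⊤).of_le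
        (by exact_mod_cast le_top)).contDiffAt, ← mul_add]
      gcongr
      exact norm_add_le _ _)
    (by
      intro c f
      rw [Real.mul_iSup_of_nonneg (norm_nonneg c)]
      congr 1
      ext x
      have h3 : ((c • f).toSchwartz : Space d → ℂ) = c • (f.toSchwartz : Space d → ℂ) := by
        rw [map_smul]; rfl
      rw [h3, iteratedFDeriv_const_smul_apply ((f.toSchwartz.smooth ⊤).of_le
        (by exact_mod_cast le_top)).contDiffAt, norm_smul]
      ring)

/-- The seminorm `sup_ξ e^{lam ω(ξ)} |D^n f̂(ξ)|`. -/
def seminormFourier (ω : WeightFunction) (d : ℕ) (p : Ioi (0 : ℝ) × ℕ) :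
    Seminorm ℂ (OmegaSchwartz ω d) :=
  Seminorm.of
    (fun f => ⨆ x, Real.exp (p.1 * ω ‖x‖) *
      ‖iteratedFDeriv ℝ p.2 (fourierInt (f.toSchwartz : Space d → ℂ)) x‖)
    (by
      intro f g
      refine ciSup_le fun x => ?_
      have h1 := le_ciSup (f.hasOmegaDecay_fourierInt p.1 p.1.2 p.2) x
      have h2 := le_ciSup (g.hasOmegaDecay_fourierInt p.1 p.1.2 p.2) x
      refine le_trans ?_ (add_le_add h1 h2)
      rw [map_add, fourierInt_add, iteratedFDeriv_add_apply ((contDiff_fourierInt _).of_le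
        (by exact_mod_cast le_top)).contDiffAt ((contDiff_fourierInt _).of_le
        (by exact_mod_cast le_top)).contDiffAt, ← mul_add]
      gcongr
      exact norm_add_le _ _)
    (by
      intro c f
      rw [Real.mul_iSup_of_nonneg (norm_nonneg c)]
      congr 1
      ext x
      rw [map_smul, fourierInt_smul, iteratedFDeriv_const_smul_apply ((contDiff_fourierInt _).of_le
        (by exact_mod_cast le_top)).contDiffAt, norm_smul]
      ring)

/-- The two families of seminorms that define the topology of `S_ω(ℝ^d)`. -/
def omegaSeminormFamily (ω : WeightFunction) (d : ℕ) :
    SeminormFamily ℂ (OmegaSchwartz ω d) ((Ioi (0 : ℝ) × ℕ) ⊕ (Ioi (0 : ℝ) × ℕ)) :=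
  Sum.elim (seminormSpace ω d) (seminormFourier ω d)

instance : TopologicalSpace (OmegaSchwartz ω d) :=
  (omegaSeminormFamily ω d).moduleFilterBasis.topology

theorem omega_withSeminorms : WithSeminorms (omegaSeminormFamily ω d) := ⟨rfl⟩

instance : IsTopologicalAddGroup (OmegaSchwartz ω d) :=
  omega_withSeminorms.topologicalAddGroup

instance : ContinuousSMul ℂ (OmegaSchwartz ω d) :=
  omega_withSeminorms.continuousSMul

/-- The space `S'_ω(ℝ^d)` of `ω`-tempered distributions: the continuous linear functionals on
`S_ω(ℝ^d)`. -/
abbrev OmegaDistribution (ω : WeightFunction) (d : ℕ) : Type := OmegaSchwartz ω d →L[ℂ] ℂ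

/-! The short-time Fourier transform. -/

/-- The complex conjugate of a function in `S_ω(ℝ^d)`. -/
def OmegaSchwartz.conj (f : OmegaSchwartz ω d) : OmegaSchwartz ω d :=
  ⟨SchwartzMap.postcompCLM (𝕜 := ℝ) (Complex.conjCLE : ℂ →L[ℝ] ℂ) f.toSchwartz, by
    refine ⟨f.hasOmegaDecay.conj, ?_⟩
    have h : fourierInt (SchwartzMap.postcompCLM (𝕜 := ℝ) (Complex.conjCLE : ℂ →L[ℝ] ℂ)
        f.toSchwartz : Space d → ℂ) = _ := fourierInt_conj (f.toSchwartz : Space d → ℂ)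
    rw [h]
    exact f.hasOmegaDecay_fourierInt.comp_neg.conj⟩

/-- The phase-space shift `(Π(z) f)(y) = e^{i⟨y, ξ⟩} f(y - x)`, where `z = (x, ξ)`. -/
def phaseShift (z : PhaseSpace d) (f : OmegaSchwartz ω d) : OmegaSchwartz ω d :=
  ⟨SchwartzMap.smulLeftCLM ℂ (character z.snd) (f.toSchwartz.compSubConstCLM ℂ z.fst), by
    have h : (SchwartzMap.smulLeftCLM ℂ (character z.snd)
        (f.toSchwartz.compSubConstCLM ℂ z.fst) : Space d → ℂ) =
        fun y => character z.snd y * f.toSchwartz (y - z.fst) := by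
      ext y
      rw [SchwartzMap.smulLeftCLM_apply_apply (hasTemperateGrowth_character _)]
      rfl
    have h1 : ContDiff ℝ (⊤ : ℕ∞) (fun y => f.toSchwartz (y - z.fst)) :=
      (f.toSchwartz.smooth ⊤).comp (contDiff_id.sub contDiff_const)
    have h2 : ContDiff ℝ (⊤ : ℕ∞) (fun η => fourierInt (f.toSchwartz : Space d → ℂ) (η - z.snd)) :=
      (contDiff_fourierInt f.toSchwartz).comp (contDiff_id.sub contDiff_const)
    refine ⟨?_, ?_⟩
    · rw [h]
      exact (f.hasOmegaDecay.comp_sub z.fst).character_mul h1 z.snd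
    · rw [h, fourierInt_shift]
      exact ((f.hasOmegaDecay_fourierInt.comp_sub z.snd).character_mul h2 _).const_smul
        ((contDiff_character _).mul h2) _⟩

theorem OmegaSchwartz.conj_apply (f : OmegaSchwartz ω d) (y : Space d) :
    f.conj.toSchwartz y = (starRingEnd ℂ) (f.toSchwartz y) := rfl

theorem phaseShift_apply (z : PhaseSpace d) (f : OmegaSchwartz ω d) (y : Space d) :
    (phaseShift z f).toSchwartz y =
      Complex.exp (Complex.I * (inner ℝ y z.snd : ℝ)) * f.toSchwartz (y - z.fst) :=
  SchwartzMap.smulLeftCLM_apply_apply (hasTemperateGrowth_character _) _ _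

/-- The action of `u` on `S_ω(ℝ^d)`, conjugate linear in the second variable and consistent with the
inner product `∫ u(y) conj(f(y)) dy`. -/
def pairing (u : OmegaDistribution ω d) (f : OmegaSchwartz ω d) : ℂ := u f.conj

/-- The short-time Fourier transform `V_φ u(z) = ⟨u, Π(z) φ⟩`. -/
def stft (φ : OmegaSchwartz ω d) (u : OmegaDistribution ω d) (z : PhaseSpace d) : ℂ :=
  pairing u (phaseShift z φ)

/-! The `ω`-wave front set. -/

/-- Open conic subsets of `ℝ^{2d} ∖ {0}`. -/
structure IsOpenConic (Γ : Set (PhaseSpace d)) : Prop where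
  isOpen : IsOpen Γ
  zero_notMem : (0 : PhaseSpace d) ∉ Γ
  smul_mem : ∀ z ∈ Γ, ∀ t : ℝ, 0 < t → t • z ∈ Γ

/-- `sup_{z ∈ Γ} e^{lam ω(z)} |V_φ u(z)| < ∞` for all `lam > 0`. -/
def StftDecaysOn (φ : OmegaSchwartz ω d) (u : OmegaDistribution ω d)
    (Γ : Set (PhaseSpace d)) : Prop :=
  ∀ lam : ℝ, 0 < lam → BddAbove ((fun z => Real.exp (lam * ω ‖z‖) * ‖stft φ u z‖) '' Γ)

/-- The `ω`-wave front set of `u`, computed with the window `φ`. -/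
def waveFrontSet (φ : OmegaSchwartz ω d) (u : OmegaDistribution ω d) : Set (PhaseSpace d) :=
  {z₀ | z₀ ≠ 0 ∧ ¬ ∃ Γ : Set (PhaseSpace d), IsOpenConic Γ ∧ z₀ ∈ Γ ∧ StftDecaysOn φ u Γ}

end OmegaGabor

end

noncomputable section

namespace OmegaGabor

open Filter Topology

variable {d : ℕ} {ω : WeightFunction}

/-! ### Weight functions -/

/-! Write Π(w) for the phase-space shift, χ = conj φ and χ' = conj ψ. Up to the reflection (x, ξ) ↦
(x, -ξ), which is harmless for norms, V_φ u(w) is u(Π(w)χ), so windows can be compared through the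
inversion formula K f = ∫ ⟨f, Π(w)χ⟩ Π(w)χ dw with K = (2π)^d ‖χ‖² > 0.

Apply u to this formula for f = Π(z)χ'. By covariance the coefficient has modulus |⟨χ', Π(w - z)χ⟩|,
whence |u(Π(z)χ')| ≤ K⁻¹ ∫ |⟨χ', Π(w - z)χ⟩| |u(Π(w)χ)| dw (`norm_shift_le_integral`). The kernel
decays in w - z faster than every e^{-Lω} (`norm_coeff_le`), while u(Π(w)χ) grows at most like
e^{mω(w)} (`OmegaDistribution.shift_growth`).

Let z ∈ Γ'. If |w - z| < δ|z|, then w ∈ Γ (`IsOpenConic.exists_relative_distance`); the decay on Γ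
and ω(z) ≤ ω(w) + ω(w - z) give the bound. Otherwise |z| ≤ δ⁻¹|w - z|, and subadditivity yields ω(z)
≤ (N + 1) ω(w - z): both the factor e^{λω(z)} and the growth of u are absorbed by the kernel.

The analytic point is that u may be moved inside the integral (`OmegaDistribution.map_integral`).
Only finitely many seminorms bound u, so u factors through a finite product of Banach spaces of
bounded continuous functions, where the Bochner integral commutes with continuous functionals. -/

theorem WeightFunction.mono (ω : WeightFunction) {s t : ℝ} (hs : 0 ≤ s) (h : s ≤ t) : ω s ≤ ω t :=
  ω.monotoneOn' hs (hs.trans h) h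

theorem WeightFunction.norm_nonneg (ω : WeightFunction) {E : Type*} [SeminormedAddCommGroup E]
    (x : E) : 0 ≤ ω ‖x‖ := ω.nonneg' _ (_root_.norm_nonneg x)

theorem WeightFunction.norm_le_add (ω : WeightFunction) {E : Type*} [SeminormedAddCommGroup E]
    {x y z : E} (h : ‖x‖ ≤ ‖y‖ + ‖z‖) : ω ‖x‖ ≤ ω ‖y‖ + ω ‖z‖ :=
  (ω.mono (_root_.norm_nonneg x) h).trans
    (ω.subadditive' _ _ (_root_.norm_nonneg y) (_root_.norm_nonneg z))

theorem WeightFunction.continuous_comp_norm (ω : WeightFunction) {E : Type*}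
    [SeminormedAddCommGroup E] : Continuous fun x : E => ω ‖x‖ :=
  ω.continuousOn'.comp_continuous continuous_norm _root_.norm_nonneg

theorem WeightFunction.nat_mul_le (ω : WeightFunction) (N : ℕ) {t : ℝ} (ht : 0 ≤ t) :
    ω ((N + 1 : ℕ) * t) ≤ (N + 1 : ℕ) * ω t := by
  induction N with
  | zero => simp
  | succ N ih =>
    have h := ω.subadditive' (((N + 1 : ℕ) : ℝ) * t) t (by positivity) ht
    have h1 : (((N + 1 + 1 : ℕ) : ℝ)) * t = ((N + 1 : ℕ) : ℝ) * t + t := by push_cast; ring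
    rw [h1]
    refine h.trans ?_
    push_cast at ih ⊢
    linarith

/-- A weight function dominates the logarithm. -/
theorem WeightFunction.exists_one_add_le (ω : WeightFunction) :
    ∃ C : ℝ, 0 < C ∧ ∀ t : ℝ, 0 ≤ t → 1 + t ≤ C * Real.exp (ω t) := by
  have h := ω.log_isLittleO'.bound one_pos
  obtain ⟨T, hT⟩ := Filter.eventually_atTop.1 (h.and (eventually_ge_atTop (1 : ℝ)))
  have hT1 : 1 ≤ T := (hT T le_rfl).2
  -- Beyond T the bound log t ≤ ω(t) gives 1 + t ≤ 2 e^{ω(t)}; below T, 1 + t ≤ 1 + T suffices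
  -- because e^ω ≥ 1.
  refine ⟨2 + T, by linarith, fun t ht => ?_⟩
  have he : 1 ≤ Real.exp (ω t) := Real.one_le_exp (ω.nonneg' t ht)
  rcases le_total T t with h1 | h1
  · have h2 := (hT t h1).1
    have h3 : (1 : ℝ) ≤ t := (hT t h1).2
    rw [one_mul, Real.norm_of_nonneg (Real.log_nonneg h3), Real.norm_of_nonneg (ω.nonneg' t ht)] at h2
    have h4 : t ≤ Real.exp (ω t) := by
      rw [← Real.exp_log (by linarith : 0 < t)]
      simpa [Real.exp_log (by linarith : 0 < t)] using Real.exp_le_exp.2 h2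
    nlinarith
  · nlinarith

theorem WeightFunction.tendsto_atTop (ω : WeightFunction) : Tendsto ω atTop atTop := by
  obtain ⟨C, hC, h⟩ := ω.exists_one_add_le
  have h1 : Tendsto (fun t : ℝ => Real.log (C⁻¹ * (1 + t))) atTop atTop :=
    Real.tendsto_log_atTop.comp
      ((tendsto_atTop_add_const_left _ _ tendsto_id).const_mul_atTop (inv_pos.2 hC))
  refine tendsto_atTop_mono' _ ?_ h1
  filter_upwards [eventually_ge_atTop 0] with t ht
  rw [← Real.log_exp (ω t)]
  refine Real.log_le_log (by positivity) ?_
  rw [inv_mul_le_iff₀ hC]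
  exact h t ht

theorem WeightFunction.tendsto_exp_neg_cocompact (ω : WeightFunction) :
    Tendsto (fun x : Space d => Real.exp (-ω ‖x‖)) (cocompact (Space d)) (𝓝 0) :=
  Real.tendsto_exp_neg_atTop_nhds_zero.comp
    (ω.tendsto_atTop.comp (tendsto_norm_cocompact_atTop (E := Space d)))

/-- Since e^{-ω} is at most a multiple of (1 + |x|)⁻¹, its power d + 1 is integrable on ℝ^d. This
rate k is what every later estimate sacrifices to gain integrability. -/
theorem WeightFunction.exists_integrable_exp_neg (ω : WeightFunction) (d : ℕ) :
    ∃ k : ℝ, 0 < k ∧ Integrable fun x : Space d => Real.exp (-(k * ω ‖x‖)) := by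
  obtain ⟨C, hC, h⟩ := ω.exists_one_add_le
  refine ⟨(d + 1 : ℕ), by positivity, ?_⟩
  have h1 : Integrable (fun x : Space d => (1 + ‖x‖) ^ (-((d + 1 : ℕ) : ℝ))) :=
    integrable_one_add_norm (by simp)
  refine (h1.const_mul (C ^ (d + 1))).mono' ?_ (Eventually.of_forall fun x => ?_)
  · have := ω.continuous_comp_norm (E := Space d)
    exact Continuous.aestronglyMeasurable (by fun_prop)
  · have h2 := h ‖x‖ (_root_.norm_nonneg x)
    have h0 : 0 < 1 + ‖x‖ := by positivity
    rw [Real.norm_of_nonneg (Real.exp_pos _).le, Real.exp_neg, Real.exp_nat_mul,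
      Real.rpow_neg h0.le, Real.rpow_natCast, ← div_eq_mul_inv, inv_eq_one_div,
      div_le_div_iff₀ (by positivity) (by positivity), one_mul, ← mul_pow]
    gcongr

/-- The sum of the weights of the two components of a point of phase space. -/
def pairWeight (ω : WeightFunction) (w : Space d × Space d) : ℝ := ω ‖w.1‖ + ω ‖w.2‖

theorem pairWeight_nonneg (w : Space d × Space d) : 0 ≤ pairWeight ω w :=
  add_nonneg (ω.norm_nonneg _) (ω.norm_nonneg _)

theorem continuous_pairWeight : Continuous (pairWeight ω (d := d)) :=
  (ω.continuous_comp_norm.comp continuous_fst).add (ω.continuous_comp_norm.comp continuous_snd)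

theorem exists_integrable_exp_neg_pairWeight (ω : WeightFunction) (d : ℕ) :
    ∃ k : ℝ, 0 < k ∧ Integrable fun w : Space d × Space d => Real.exp (-(k * pairWeight ω w)) := by
  obtain ⟨k, hk, h⟩ := ω.exists_integrable_exp_neg d
  refine ⟨k, hk, ?_⟩
  refine (h.mul_prod h).congr (Eventually.of_forall fun w => ?_)
  dsimp only
  rw [← Real.exp_add, pairWeight]
  ring_nf

theorem norm_toLp_le (w : Space d × Space d) : ‖WithLp.toLp 2 w‖ ≤ ‖w.1‖ + ‖w.2‖ := by
  have h : ‖WithLp.toLp 2 w‖ ^ 2 = ‖w.1‖ ^ 2 + ‖w.2‖ ^ 2 := WithLp.prod_norm_sq_eq_of_L2 _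
  refine le_of_sq_le_sq ?_ (by positivity)
  nlinarith [norm_nonneg w.1, norm_nonneg w.2, mul_nonneg (norm_nonneg w.1) (norm_nonneg w.2)]

theorem weight_toLp_le (w : Space d × Space d) : ω ‖WithLp.toLp 2 w‖ ≤ pairWeight ω w :=
  (ω.mono (norm_nonneg _) (norm_toLp_le w)).trans
    (ω.subadditive' _ _ (norm_nonneg _) (norm_nonneg _))

/-- With `weight_toLp_le`, this makes the Euclidean weight and the additive one interchangeable. The
additive weight factorizes under exp, which suits product integrals. -/
theorem pairWeight_le (w : Space d × Space d) : pairWeight ω w ≤ 2 * ω ‖WithLp.toLp 2 w‖ := by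
  have h : ‖WithLp.toLp 2 w‖ ^ 2 = ‖w.1‖ ^ 2 + ‖w.2‖ ^ 2 := WithLp.prod_norm_sq_eq_of_L2 _
  have h1 : ‖w.1‖ ≤ ‖WithLp.toLp 2 w‖ :=
    le_of_sq_le_sq (by nlinarith [sq_nonneg ‖w.2‖]) (norm_nonneg _)
  have h2 : ‖w.2‖ ≤ ‖WithLp.toLp 2 w‖ :=
    le_of_sq_le_sq (by nlinarith [sq_nonneg ‖w.1‖]) (norm_nonneg _)
  have h3 := ω.mono (norm_nonneg _) h1
  have h4 := ω.mono (norm_nonneg _) h2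
  rw [pairWeight]
  linarith

/-! ### Families of smooth functions and their integrals -/

section Families

variable {W X F : Type*} [NormedAddCommGroup X] [NormedSpace ℝ X]

/-- Joint smoothness survives differentiation in the second variable, by induction through currying.
The resulting joint continuity provides measurability in the parameter and continuity in the uniform
norm. -/
theorem contDiff_iteratedFDeriv_uncurry [NormedAddCommGroup W] [NormedSpace ℝ W]
    [NormedAddCommGroup F] [NormedSpace ℝ F] {g : W → X → F}
    (hg : ContDiff ℝ (⊤ : ℕ∞) (Function.uncurry g)) (n : ℕ) :
    ContDiff ℝ (⊤ : ℕ∞) (Function.uncurry fun w => iteratedFDeriv ℝ n (g w)) := by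
  induction n with
  | zero =>
    have h : (Function.uncurry fun w => iteratedFDeriv ℝ 0 (g w)) =
        (continuousMultilinearCurryFin0 ℝ X F).symm ∘ Function.uncurry g := by
      ext p; rfl
    rw [h]
    exact (LinearIsometryEquiv.contDiff _).comp hg
  | succ n ih =>
    have h : (Function.uncurry fun w => iteratedFDeriv ℝ (n + 1) (g w)) =
        (continuousMultilinearCurryLeftEquiv ℝ (fun _ => X) F).symm ∘
          fun p : W × X => fderiv ℝ (iteratedFDeriv ℝ n (g p.1)) p.2 := by
      ext p; rw [Function.uncurry, iteratedFDeriv_succ_eq_comp_left]; rfl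
    rw [h]
    have h0 := LinearIsometryEquiv.contDiff (𝕜 := ℝ) (n := (⊤ : ℕ∞)) (E := X →L[ℝ] X [×n]→L[ℝ] F)
      (F := X [×(n + 1)]→L[ℝ] F)
      (continuousMultilinearCurryLeftEquiv ℝ (fun _ : Fin (n + 1) => X) F).symm
    have h1 : ContDiff ℝ (⊤ : ℕ∞)
        (Function.uncurry fun p : W × X => iteratedFDeriv ℝ n (g p.1)) :=
      ih.comp ((contDiff_fst.comp contDiff_fst).prodMk contDiff_snd)
    exact h0.comp (h1.fderiv contDiff_snd (by simp))

/-- Induction on the order, differentiating under the integral sign. The dominating functions are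
uniform in x, so no localization is needed. -/
theorem iteratedFDeriv_integral_mul [NormedAddCommGroup W] [NormedSpace ℝ W]
    [MeasurableSpace W] [BorelSpace W] [SecondCountableTopology W] {μ : Measure W}
    [FiniteDimensional ℝ X]
    {g : W → X → ℂ} (hg : ContDiff ℝ (⊤ : ℕ∞) (Function.uncurry g)) {c : W → ℂ} (hc : Continuous c)
    (hb : ∀ n : ℕ, ∃ M : W → ℝ, (∀ w x, ‖iteratedFDeriv ℝ n (g w) x‖ ≤ M w) ∧
      Integrable (fun w => ‖c w‖ * M w) μ) (n : ℕ) :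
    (∀ x, Integrable (fun w => c w • iteratedFDeriv ℝ n (g w) x) μ) ∧
    iteratedFDeriv ℝ n (fun x => ∫ w, c w * g w x ∂μ) =
      fun x => ∫ w, c w • iteratedFDeriv ℝ n (g w) x ∂μ := by
  have hmeas : ∀ n x, AEStronglyMeasurable (fun w => c w • iteratedFDeriv ℝ n (g w) x) μ := by
    intro n x
    have h := (contDiff_iteratedFDeriv_uncurry hg n).continuous
    have h2 : Continuous fun w => iteratedFDeriv ℝ n (g w) x :=
      h.comp (Continuous.prodMk_left x)
    exact (hc.smul h2).aestronglyMeasurable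
  have hint : ∀ n x, Integrable (fun w => c w • iteratedFDeriv ℝ n (g w) x) μ := by
    intro n x
    obtain ⟨M, hM, hi⟩ := hb n
    refine hi.mono' (hmeas n x) (Eventually.of_forall fun w => ?_)
    rw [norm_smul]
    gcongr
    exact hM w x
  refine ⟨hint n, ?_⟩
  induction n with
  | zero =>
    ext x m
    rw [iteratedFDeriv_zero_apply]
    have := (ContinuousMultilinearMap.apply ℝ (fun _ : Fin 0 => X) ℂ m).integral_comp_comm (hint 0 x)
    rw [← ContinuousMultilinearMap.apply_apply, ← this]
    rfl
  | succ n ih =>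
    obtain ⟨M, hM, hi⟩ := hb (n + 1)
    -- The inductive step takes place in the curried space, where the derivative of the n-th
    -- derivative lives; `L` is an isometry, so the bound of order n + 1 dominates it.
    let L : (X [×(n + 1)]→L[ℝ] ℂ) ≃ₗᵢ[ℝ] (X →L[ℝ] X [×n]→L[ℝ] ℂ) :=
      (continuousMultilinearCurryLeftEquiv ℝ (fun _ : Fin (n + 1) => X) ℂ)
    have hL : ∀ w x, fderiv ℝ (iteratedFDeriv ℝ n (g w)) x = L (iteratedFDeriv ℝ (n + 1) (g w) x) := by
      intro w x
      rw [iteratedFDeriv_succ_eq_comp_left, Function.comp, LinearIsometryEquiv.apply_symm_apply]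
    have hsmul : ∀ w x, L (c w • iteratedFDeriv ℝ (n + 1) (g w) x) =
        c w • fderiv ℝ (iteratedFDeriv ℝ n (g w)) x := by
      intro w x
      rw [hL]
      rfl
    have key : ∀ x, HasFDerivAt (fun x => ∫ w, c w • iteratedFDeriv ℝ n (g w) x ∂μ)
        (∫ w, L (c w • iteratedFDeriv ℝ (n + 1) (g w) x) ∂μ) x := by
      intro x
      refine hasFDerivAt_integral_of_dominated_of_fderiv_le (𝕜 := ℝ)
        (F' := fun x w => L (c w • iteratedFDeriv ℝ (n + 1) (g w) x))
        (bound := fun w => ‖c w‖ * M w) univ_mem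
        (Eventually.of_forall fun x => hmeas n x) (hint n x) ?_ ?_ hi ?_
      · exact L.continuous.comp_aestronglyMeasurable (hmeas (n + 1) x)
      · refine Eventually.of_forall fun w y _ => ?_
        rw [LinearIsometryEquiv.norm_map, norm_smul]
        gcongr
        exact hM w y
      · refine Eventually.of_forall fun w y _ => ?_
        have hgw : ContDiff ℝ (⊤ : ℕ∞) (g w) := hg.comp (contDiff_prodMk_right w)
        have h := (hgw.differentiable_iteratedFDeriv (m := n)
          (by exact_mod_cast WithTop.coe_lt_top _)) y
        rw [hsmul]
        exact h.hasFDerivAt.const_smul (c w)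
    rw [iteratedFDeriv_succ_eq_comp_left, ih]
    ext1 x
    rw [Function.comp, (key x).fderiv]
    refine L.injective ((L.apply_symm_apply _).trans ?_)
    exact ContinuousLinearEquiv.integral_comp_comm (𝕜 := ℝ) (E := X [×(n + 1)]→L[ℝ] ℂ)
      (F := X →L[ℝ] X [×n]→L[ℝ] ℂ) L.toContinuousLinearEquiv (μ := μ)
      fun w => c w • iteratedFDeriv ℝ (n + 1) (g w) x

end Families

/-- Joint continuity together with locally uniform decay at infinity gives continuity of a family of
functions in the uniform norm. -/
theorem continuous_boundedContinuousFunction {W X F : Type*} [TopologicalSpace W]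
    [TopologicalSpace X] [NormedAddCommGroup F] {G : W → BoundedContinuousFunction X F}
    (hG : Continuous fun p : W × X => G p.1 p.2) {M : W → ℝ} (hM : Continuous M) {η : X → ℝ}
    (hη : Tendsto η (cocompact X) (𝓝 0)) (hη0 : ∀ x, 0 ≤ η x)
    (h : ∀ w x, ‖G w x‖ ≤ M w * η x) : Continuous G := by
  rw [continuous_iff_continuousAt]
  intro w₀
  rw [ContinuousAt, Metric.tendsto_nhds]
  intro ε hε
  have h1 : ∀ᶠ w in 𝓝 w₀, M w < |M w₀| + 1 :=
    hM.continuousAt.eventually_lt continuousAt_const (by linarith [le_abs_self (M w₀)])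
  have h2 : ∀ᶠ x in cocompact X, η x < ε / 4 / (|M w₀| + 1) :=
    hη.eventually_lt_const (by positivity)
  -- Outside the compact set `K` both functions have norm at most ε/4; on `K` compactness turns
  -- joint continuity into uniform closeness for w near w₀.
  obtain ⟨K, hK, hKc⟩ := mem_cocompact.1 h2
  have h3 : ∀ᶠ w in 𝓝 w₀, ∀ x ∈ K, dist (G w x) (G w₀ x) < ε / 2 := by
    refine hK.eventually_forall_of_forall_eventually fun y _ => ?_
    have hcont : Continuous fun p : W × X => dist (G p.1 p.2) (G w₀ p.2) :=
      hG.dist ((G w₀).continuous.comp continuous_snd)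
    refine hcont.continuousAt.eventually_lt continuousAt_const ?_
    simpa using half_pos hε
  filter_upwards [h1, h3] with w hw hwK
  refine lt_of_le_of_lt ((BoundedContinuousFunction.dist_le (half_pos hε).le).2 fun x => ?_)
    (half_lt_self hε)
  by_cases hx : x ∈ K
  · exact (hwK x hx).le
  · have hx' : η x < ε / 4 / (|M w₀| + 1) := hKc hx
    rw [lt_div_iff₀ (by positivity)] at hx'
    have ha : ‖G w x‖ ≤ ε / 4 := by
      refine (h w x).trans (le_trans ?_ hx'.le)
      rw [mul_comm]
      exact mul_le_mul_of_nonneg_left hw.le (hη0 x)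
    have hb : ‖G w₀ x‖ ≤ ε / 4 := by
      refine (h w₀ x).trans (le_trans ?_ hx'.le)
      rw [mul_comm]
      exact mul_le_mul_of_nonneg_left (by linarith [le_abs_self (M w₀)]) (hη0 x)
    refine (dist_le_norm_add_norm _ _).trans ?_
    linarith

/-! ### Continuous functionals commute with integrals -/

/-- The functions controlled by the two families of seminorms: `f` and its Fourier transform. -/
def OmegaSchwartz.component (f : OmegaSchwartz ω d) :
    (Ioi (0 : ℝ) × ℕ) ⊕ (Ioi (0 : ℝ) × ℕ) → Space d → ℂ :=
  Sum.elim (fun _ => f.toSchwartz) (fun _ => fourierInt f.toSchwartz)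

/-- The exponent and the order of differentiation of a seminorm. -/
def seminormParam (i : (Ioi (0 : ℝ) × ℕ) ⊕ (Ioi (0 : ℝ) × ℕ)) : Ioi (0 : ℝ) × ℕ :=
  Sum.elim id id i

theorem OmegaSchwartz.contDiff_component (f : OmegaSchwartz ω d)
    (i : (Ioi (0 : ℝ) × ℕ) ⊕ (Ioi (0 : ℝ) × ℕ)) : ContDiff ℝ (⊤ : ℕ∞) (f.component i) := by
  rcases i with i | i
  · exact f.toSchwartz.smooth ⊤
  · exact contDiff_fourierInt f.toSchwartz

theorem OmegaSchwartz.hasOmegaDecay_component (f : OmegaSchwartz ω d)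
    (i : (Ioi (0 : ℝ) × ℕ) ⊕ (Ioi (0 : ℝ) × ℕ)) : HasOmegaDecay ω (f.component i) := by
  rcases i with i | i
  · exact f.hasOmegaDecay
  · exact f.hasOmegaDecay_fourierInt

theorem OmegaSchwartz.component_add (f g : OmegaSchwartz ω d)
    (i : (Ioi (0 : ℝ) × ℕ) ⊕ (Ioi (0 : ℝ) × ℕ)) :
    (f + g).component i = f.component i + g.component i := by
  rcases i with i | i
  · simp only [component, Sum.elim_inl, map_add]; rfl
  · simp only [component, Sum.elim_inr, map_add, fourierInt_add]

theorem OmegaSchwartz.component_smul (c : ℂ) (f : OmegaSchwartz ω d)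
    (i : (Ioi (0 : ℝ) × ℕ) ⊕ (Ioi (0 : ℝ) × ℕ)) : (c • f).component i = c • f.component i := by
  rcases i with i | i
  · simp only [component, Sum.elim_inl, map_smul]; rfl
  · simp only [component, Sum.elim_inr, map_smul, fourierInt_smul]

theorem omegaSeminormFamily_apply (i : (Ioi (0 : ℝ) × ℕ) ⊕ (Ioi (0 : ℝ) × ℕ))
    (f : OmegaSchwartz ω d) :
    omegaSeminormFamily ω d i f = ⨆ x, Real.exp ((seminormParam i).1 * ω ‖x‖) *
      ‖iteratedFDeriv ℝ (seminormParam i).2 (f.component i) x‖ := by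
  rcases i with i | i <;> rfl

/-- The values of the `n`-th derivative of a function on `ℝ^d`, as a normed space over `ℂ`. -/
def JetSpace (d n : ℕ) : Type := Space d [×n]→L[ℝ] ℂ

instance (n : ℕ) : NormedAddCommGroup (JetSpace d n) :=
  inferInstanceAs (NormedAddCommGroup (Space d [×n]→L[ℝ] ℂ))

/-- The derivatives are real multilinear, but u is complex linear, so the complex structure of the
values has to be kept. -/
instance (n : ℕ) : NormedSpace ℂ (JetSpace d n) :=
  inferInstanceAs (NormedSpace ℂ (Space d [×n]→L[ℝ] ℂ))

instance (n : ℕ) : CompleteSpace (JetSpace d n) :=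
  inferInstanceAs (CompleteSpace (Space d [×n]→L[ℝ] ℂ))

instance (n : ℕ) : NormedSpace ℝ (JetSpace d n) :=
  inferInstanceAs (NormedSpace ℝ (Space d [×n]→L[ℝ] ℂ))

instance (n : ℕ) : IsScalarTower ℝ ℂ (JetSpace d n) :=
  inferInstanceAs (IsScalarTower ℝ ℂ (Space d [×n]→L[ℝ] ℂ))

instance (n : ℕ) : SMulCommClass ℝ ℂ (JetSpace d n) :=
  inferInstanceAs (SMulCommClass ℝ ℂ (Space d [×n]→L[ℝ] ℂ))

/-- The `n`-th derivative of a function, with values in `JetSpace d n`. -/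
def jet (n : ℕ) (F : Space d → ℂ) (x : Space d) : JetSpace d n := iteratedFDeriv ℝ n F x

theorem norm_jet (n : ℕ) (F : Space d → ℂ) (x : Space d) :
    ‖jet n F x‖ = ‖iteratedFDeriv ℝ n F x‖ := rfl

theorem jet_add {n : ℕ} {F G : Space d → ℂ} (hF : ContDiff ℝ (⊤ : ℕ∞) F)
    (hG : ContDiff ℝ (⊤ : ℕ∞) G) (x : Space d) : jet n (F + G) x = jet n F x + jet n G x :=
  iteratedFDeriv_add_apply (hF.of_le (by exact_mod_cast le_top)).contDiffAt
    (hG.of_le (by exact_mod_cast le_top)).contDiffAt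

theorem jet_smul {n : ℕ} {F : Space d → ℂ} (hF : ContDiff ℝ (⊤ : ℕ∞) F) (c : ℂ) (x : Space d) :
    jet n (c • F) x = c • jet n F x :=
  iteratedFDeriv_const_smul_apply (hF.of_le (by exact_mod_cast le_top)).contDiffAt

theorem continuous_jet {n : ℕ} {F : Space d → ℂ} (hF : ContDiff ℝ (⊤ : ℕ∞) F) :
    Continuous (jet n F) :=
  hF.continuous_iteratedFDeriv (by exact_mod_cast le_top)

/-- The weighted derivative `x ↦ e^{lam ω(x)} D^n f(x)`, or its analogue for the Fourier transform,
as a bounded continuous function. -/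
def weightedJet (ω : WeightFunction) (d : ℕ) (i : (Ioi (0 : ℝ) × ℕ) ⊕ (Ioi (0 : ℝ) × ℕ)) :
    OmegaSchwartz ω d →ₗ[ℂ]
      BoundedContinuousFunction (Space d) (JetSpace d (seminormParam i).2) where
  toFun f := BoundedContinuousFunction.ofNormedAddCommGroup
    (fun x => Real.exp ((seminormParam i).1 * ω ‖x‖) • jet (seminormParam i).2 (f.component i) x)
    (by
      have h1 := continuous_jet (n := (seminormParam i).2) (f.contDiff_component i)
      have h2 := ω.continuous_comp_norm (E := Space d)
      fun_prop)
    (omegaSeminormFamily ω d i f)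
    (by
      intro x
      rw [norm_smul, Real.norm_of_nonneg (Real.exp_pos _).le, norm_jet, omegaSeminormFamily_apply]
      exact le_ciSup (f.hasOmegaDecay_component i _ (seminormParam i).1.2 _) x)
  map_add' f g := by
    ext1 x
    simp only [BoundedContinuousFunction.coe_ofNormedAddCommGroup,
      BoundedContinuousFunction.coe_add, Pi.add_apply]
    rw [f.component_add, jet_add (f.contDiff_component i) (g.contDiff_component i), smul_add]
  map_smul' c f := by
    ext1 x
    simp only [BoundedContinuousFunction.coe_ofNormedAddCommGroup,
      BoundedContinuousFunction.coe_smul, RingHom.id_apply]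
    rw [f.component_smul, jet_smul (f.contDiff_component i), smul_comm]

theorem weightedJet_apply (i : (Ioi (0 : ℝ) × ℕ) ⊕ (Ioi (0 : ℝ) × ℕ)) (f : OmegaSchwartz ω d)
    (x : Space d) : weightedJet ω d i f x = Real.exp ((seminormParam i).1 * ω ‖x‖) •
      jet (seminormParam i).2 (f.component i) x := rfl

theorem norm_weightedJet_apply (i : (Ioi (0 : ℝ) × ℕ) ⊕ (Ioi (0 : ℝ) × ℕ))
    (f : OmegaSchwartz ω d) (x : Space d) :
    ‖weightedJet ω d i f x‖ = Real.exp ((seminormParam i).1 * ω ‖x‖) *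
      ‖iteratedFDeriv ℝ (seminormParam i).2 (f.component i) x‖ := by
  rw [weightedJet_apply, norm_smul, Real.norm_of_nonneg (Real.exp_pos _).le, norm_jet]

theorem omegaSeminormFamily_le_norm (i : (Ioi (0 : ℝ) × ℕ) ⊕ (Ioi (0 : ℝ) × ℕ))
    (f : OmegaSchwartz ω d) : omegaSeminormFamily ω d i f ≤ ‖weightedJet ω d i f‖ := by
  rw [omegaSeminormFamily_apply]
  refine ciSup_le fun x => ?_
  rw [← norm_weightedJet_apply]
  exact (weightedJet ω d i f).norm_coe_le_norm x

theorem OmegaDistribution.exists_bound (u : OmegaDistribution ω d) :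
    ∃ (s : Finset ((Ioi (0 : ℝ) × ℕ) ⊕ (Ioi (0 : ℝ) × ℕ))) (C : ℝ), 0 ≤ C ∧
      ∀ f, ‖u f‖ ≤ C * (s.sup (omegaSeminormFamily ω d)) f := by
  obtain ⟨s, C, -, h⟩ := Seminorm.bound_of_continuous omega_withSeminorms
    ((normSeminorm ℂ ℂ).comp u.toLinearMap) (continuous_norm.comp u.continuous)
  exact ⟨s, C, C.2, fun f => h f⟩

/-- A functional that is bounded by a linear map into a normed space factors through it. -/
theorem exists_factor_of_norm_le {E B : Type*} [AddCommGroup E] [Module ℂ E]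
    [NormedAddCommGroup B] [NormedSpace ℂ B] (u : E →ₗ[ℂ] ℂ) (T : E →ₗ[ℂ] B) (C : ℝ)
    (h : ∀ f, ‖u f‖ ≤ C * ‖T f‖) : ∃ U : B →L[ℂ] ℂ, ∀ f, U (T f) = u f := by
  -- `r` is merely a linear section of `T` over its range. The bound on u makes u ∘ r continuous
  -- there, and Hahn–Banach extends it.
  obtain ⟨r, hr⟩ := T.rangeRestrict.exists_rightInverse_of_surjective T.range_rangeRestrict
  have hr' : ∀ y, T (r y) = y := fun y => congrArg Subtype.val (LinearMap.congr_fun hr y)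
  obtain ⟨U, hU, -⟩ := exists_extension_norm_eq (LinearMap.range T)
    ((u ∘ₗ r).mkContinuous C fun y => by simpa [hr'] using h (r y))
  refine ⟨U, fun f => ?_⟩
  have h1 := hU ⟨T f, LinearMap.mem_range_self T f⟩
  rw [h1]
  -- The difference between `f` and the chosen preimage of `T f` lies in the kernel of `T`, where u
  -- vanishes by the bound.
  have h2 := h (r ⟨T f, LinearMap.mem_range_self T f⟩ - f)
  rw [map_sub, map_sub, hr', sub_self, norm_zero, mul_zero] at h2
  simpa [sub_eq_zero] using le_antisymm h2 (norm_nonneg _)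

section Superposition

variable {W : Type*} [NormedAddCommGroup W] [NormedSpace ℝ W] [MeasurableSpace W] [BorelSpace W]
  [SecondCountableTopology W]

/-- The weighted derivatives of all orders of the functions `G w` are bounded by functions of `w`
that are integrable against `c`. -/
def IsDominatedFamily (ω : WeightFunction) (μ : Measure W) (c : W → ℂ) (G : W → Space d → ℂ) :
    Prop :=
  ∀ lam : ℝ, 0 < lam → ∀ n : ℕ, ∃ M : W → ℝ, Continuous M ∧
    (∀ w x, Real.exp (lam * ω ‖x‖) * ‖iteratedFDeriv ℝ n (G w) x‖ ≤ M w) ∧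
    Integrable (fun w => ‖c w‖ * M w) μ

/-- Lifts a pointwise integral identity to a Bochner integral in the Banach space of weighted
derivatives: continuity in w gives measurability, domination gives integrability, and evaluation at
each x identifies the value. -/
theorem integral_weightedJet {μ : Measure W} {c : W → ℂ} (hc : Continuous c)
    {g : W → OmegaSchwartz ω d} {f : OmegaSchwartz ω d}
    (i : (Ioi (0 : ℝ) × ℕ) ⊕ (Ioi (0 : ℝ) × ℕ))
    (hg : ContDiff ℝ (⊤ : ℕ∞) (Function.uncurry fun w => (g w).component i))
    (hdom : IsDominatedFamily ω μ c fun w => (g w).component i)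
    (hf : ∀ x, f.component i x = ∫ w, c w * (g w).component i x ∂μ) :
    Integrable (fun w => c w • weightedJet ω d i (g w)) μ ∧
      ∫ w, c w • weightedJet ω d i (g w) ∂μ = weightedJet ω d i f := by
  have hlam : 0 < ((seminormParam i).1 : ℝ) := (seminormParam i).1.2
  have hjet : Continuous fun w => weightedJet ω d i (g w) := by
    -- One extra unit of exponent leaves a factor e^{-ω(x)}, which supplies the decay at infinity
    -- needed for continuity in the uniform norm.
    obtain ⟨M, hMc, hM, -⟩ := hdom ((seminormParam i).1 + 1) (by linarith) (seminormParam i).2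
    refine continuous_boundedContinuousFunction ?_ hMc ω.tendsto_exp_neg_cocompact
      (fun x => (Real.exp_pos _).le) fun w x => ?_
    · have h1 := (contDiff_iteratedFDeriv_uncurry hg (seminormParam i).2).continuous
      have h2 := ω.continuous_comp_norm (E := Space d)
      exact (Real.continuous_exp.comp (continuous_const.mul (h2.comp continuous_snd))).smul h1
    · rw [norm_weightedJet_apply]
      have h := mul_le_mul_of_nonneg_right (hM w x) (Real.exp_pos (-ω ‖x‖)).le
      refine le_trans (le_of_eq ?_) h
      rw [mul_right_comm, ← Real.exp_add]
      congr 2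
      ring
  have hint : Integrable (fun w => c w • weightedJet ω d i (g w)) μ := by
    obtain ⟨M, -, hM, hi⟩ := hdom (seminormParam i).1 hlam (seminormParam i).2
    refine hi.mono' (hc.smul hjet).aestronglyMeasurable (Eventually.of_forall fun w => ?_)
    rw [norm_smul]
    gcongr
    rw [BoundedContinuousFunction.norm_le]
    · intro x
      rw [norm_weightedJet_apply]
      exact hM w x
    · exact le_trans (by positivity) (hM w 0)
  refine ⟨hint, ?_⟩
  ext1 x
  have h1 := (BoundedContinuousFunction.evalCLM ℝ x
    (β := JetSpace d (seminormParam i).2)).integral_comp_comm hint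
  refine h1.symm.trans ?_
  have h2 := (iteratedFDeriv_integral_mul hg hc (μ := μ) (fun n => by
    obtain ⟨M, -, hM, hi⟩ := hdom 1 one_pos n
    refine ⟨M, fun w x => le_trans ?_ (hM w x), hi⟩
    exact le_mul_of_one_le_left (norm_nonneg _) (Real.one_le_exp (by
      simpa using ω.norm_nonneg x))) (seminormParam i).2).2
  rw [← funext hf] at h2
  have h3 : jet (seminormParam i).2 (f.component i) x =
      ∫ w, c w • jet (seminormParam i).2 ((g w).component i) x ∂μ := congrFun h2 x
  rw [weightedJet_apply, h3, ← integral_smul]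
  refine integral_congr_ae (Eventually.of_forall fun w => ?_)
  exact (smul_comm _ (c w) _).symm

/-- A continuous functional on `S_ω(ℝ^d)` commutes with absolutely convergent superpositions. -/
theorem OmegaDistribution.map_integral (u : OmegaDistribution ω d) {μ : Measure W} {c : W → ℂ}
    (hc : Continuous c) {g : W → OmegaSchwartz ω d} {f : OmegaSchwartz ω d}
    (hg : ∀ i, ContDiff ℝ (⊤ : ℕ∞) (Function.uncurry fun w => (g w).component i))
    (hdom : ∀ i, IsDominatedFamily ω μ c fun w => (g w).component i)
    (hf : ∀ i x, f.component i x = ∫ w, c w * (g w).component i x ∂μ) :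
    u f = ∫ w, c w * u (g w) ∂μ := by
  obtain ⟨s, C, hC, hu⟩ := u.exists_bound
  -- `T` collects the weighted derivatives of the finitely many seminorms in `s`, so its norm
  -- controls u.
  let T : OmegaSchwartz ω d →ₗ[ℂ] ((i : s) →
      BoundedContinuousFunction (Space d) (JetSpace d (seminormParam i.1).2)) :=
    LinearMap.pi fun i => weightedJet ω d i.1
  obtain ⟨U, hU⟩ := exists_factor_of_norm_le u.toLinearMap T C (fun f => by
    refine (hu f).trans ?_
    gcongr
    refine Seminorm.finset_sup_apply_le (norm_nonneg _) fun i hi => ?_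
    exact (omegaSeminormFamily_le_norm i f).trans (norm_le_pi_norm (T f) ⟨i, hi⟩))
  have hi : ∀ i, Integrable (fun w => c w • weightedJet ω d i (g w)) μ ∧
      ∫ w, c w • weightedJet ω d i (g w) ∂μ = weightedJet ω d i f := fun i =>
    integral_weightedJet hc i (hg i) (hdom i) (hf i)
  have hTint : Integrable (fun w => c w • T (g w)) μ := Integrable.of_eval fun i => (hi i.1).1
  have hT : ∫ w, c w • T (g w) ∂μ = T f := by
    ext1 i
    rw [eval_integral fun i => (hi i.1).1]
    exact (hi i.1).2
  have h := U.integral_comp_comm hTint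
  rw [hT, hU] at h
  refine Eq.trans h.symm (integral_congr_ae (Eventually.of_forall fun w => ?_))
  simp [hU]

end Superposition

/-! ### Phase-space shifts -/

theorem norm_character (ξ y : Space d) : ‖character ξ y‖ = 1 := by
  simp [character, Complex.norm_exp]

theorem contDiff_character_uncurry :
    ContDiff ℝ (⊤ : ℕ∞) fun p : Space d × Space d => character p.1 p.2 := by
  have h : ContDiff ℝ (⊤ : ℕ∞) fun p : Space d × Space d => ((inner ℝ p.2 p.1 : ℝ) : ℂ) :=
    Complex.ofRealCLM.contDiff.comp (contDiff_snd.inner ℝ contDiff_fst)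
  exact (contDiff_const.mul h).cexp

/-- By Leibniz, each derivative of the character costs a factor |a| ≤ D e^{ω(a)}, at most n times,
and undoing the translation in the weight costs e^{lam ω(b)} by subadditivity. -/
theorem character_mul_shift_bound {h : Space d → ℂ} (hs : ContDiff ℝ (⊤ : ℕ∞) h)
    (hd : HasOmegaDecay ω h) {lam : ℝ} (hl : 0 < lam) (n : ℕ) :
    ∃ C : ℝ, 0 ≤ C ∧ ∀ a b y : Space d, Real.exp (lam * ω ‖y‖) *
      ‖iteratedFDeriv ℝ n (fun y => character a y * h (y - b)) y‖ ≤
        C * Real.exp ((lam + n) * (ω ‖a‖ + ω ‖b‖)) := by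
  obtain ⟨D, hD, hlog⟩ := ω.exists_one_add_le
  choose A hA using fun k => hd lam hl k
  have hA0 : ∀ k, 0 ≤ A k := fun k => le_trans (by positivity) (hA k ⟨0, rfl⟩)
  refine ⟨∑ i ∈ Finset.range (n + 1), (n.choose i : ℝ) * D ^ n * A (n - i),
    Finset.sum_nonneg fun i _ => by have := hA0 (n - i); positivity, fun a b y => ?_⟩
  have hsb : ContDiff ℝ (⊤ : ℕ∞) fun y => h (y - b) := hs.comp (contDiff_id.sub contDiff_const)
  have h1 := norm_iteratedFDeriv_mul_le (contDiff_character a) hsb y (n := n)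
    (by exact_mod_cast le_top)
  refine (mul_le_mul_of_nonneg_left h1 (Real.exp_pos _).le).trans ?_
  rw [Finset.mul_sum, Finset.sum_mul]
  refine Finset.sum_le_sum fun i hi => ?_
  have hin : i ≤ n := Nat.lt_succ_iff.1 (Finset.mem_range.1 hi)
  rw [iteratedFDeriv_comp_sub]
  have h2 := hA (n - i) ⟨y - b, rfl⟩
  dsimp only at h2
  have h3 : ω ‖y‖ ≤ ω ‖b‖ + ω ‖y - b‖ :=
    ω.norm_le_add (by simpa using norm_add_le b (y - b))
  have h4 : ‖iteratedFDeriv ℝ i (character a) y‖ ≤ D ^ n * Real.exp (n * ω ‖a‖) := by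
    have h0 := norm_nonneg a
    calc _ ≤ ‖a‖ ^ i := norm_iteratedFDeriv_character_le a i y
      _ ≤ (1 + ‖a‖) ^ i := by gcongr; linarith
      _ ≤ (1 + ‖a‖) ^ n := pow_le_pow_right₀ (by linarith) hin
      _ ≤ (D * Real.exp (ω ‖a‖)) ^ n := by gcongr; exact hlog _ h0
      _ = _ := by rw [mul_pow, ← Real.exp_nat_mul]
  have ha := ω.norm_nonneg a
  have hb := ω.norm_nonneg b
  calc _ ≤ Real.exp (lam * (ω ‖b‖ + ω ‖y - b‖)) * ((n.choose i : ℝ) *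
        (D ^ n * Real.exp (n * ω ‖a‖)) * ‖iteratedFDeriv ℝ (n - i) h (y - b)‖) := by gcongr
    _ = (n.choose i : ℝ) * D ^ n * (Real.exp (lam * ω ‖y - b‖) *
        ‖iteratedFDeriv ℝ (n - i) h (y - b)‖) *
          (Real.exp (n * ω ‖a‖) * Real.exp (lam * ω ‖b‖)) := by
      rw [mul_add, Real.exp_add]; ring
    _ ≤ (n.choose i : ℝ) * D ^ n * A (n - i) * Real.exp ((lam + n) * (ω ‖a‖ + ω ‖b‖)) := by
      have := hA0 (n - i)
      rw [← Real.exp_add]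
      gcongr
      nlinarith [mul_nonneg hl.le ha, mul_nonneg (Nat.cast_nonneg (α := ℝ) n) hb]

/-- The phase-space shift by `(x, ξ)`. -/
abbrev shift (w : Space d × Space d) (χ : OmegaSchwartz ω d) : OmegaSchwartz ω d :=
  phaseShift (WithLp.toLp 2 w) χ

theorem shift_apply (w : Space d × Space d) (χ : OmegaSchwartz ω d) (y : Space d) :
    (shift w χ).toSchwartz y = character w.2 y * χ.toSchwartz (y - w.1) := phaseShift_apply _ _ _

/-- The constant of modulus one in the action of a phase-space shift on a component. -/
def componentPhase (i : (Ioi (0 : ℝ) × ℕ) ⊕ (Ioi (0 : ℝ) × ℕ)) (w : Space d × Space d) : ℂ :=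
  Sum.elim (fun _ => 1) (fun _ => character w.2 w.1) i

/-- The modulation and the translation by which a phase-space shift acts on a component. -/
def componentShift (i : (Ioi (0 : ℝ) × ℕ) ⊕ (Ioi (0 : ℝ) × ℕ)) (w : Space d × Space d) :
    Space d × Space d :=
  Sum.elim (fun _ => (w.2, w.1)) (fun _ => (-w.1, w.2)) i

/-- The Fourier transform turns translation by x and modulation by ξ into modulation by -x and
translation by ξ, up to a unimodular constant. Thus f and its Fourier transform can be estimated by
the same argument. -/
theorem component_shift (i : (Ioi (0 : ℝ) × ℕ) ⊕ (Ioi (0 : ℝ) × ℕ)) (w : Space d × Space d)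
    (χ : OmegaSchwartz ω d) : (shift w χ).component i = componentPhase i w • fun y =>
      character (componentShift i w).1 y * χ.component i (y - (componentShift i w).2) := by
  rcases i with i | i
  · ext y
    rw [Pi.smul_apply, componentPhase, Sum.elim_inl, one_smul]
    exact shift_apply w χ y
  · have h : ((shift w χ).toSchwartz : Space d → ℂ) =
        fun y => character w.2 y * χ.toSchwartz (y - w.1) := funext (shift_apply w χ)
    change fourierInt ((shift w χ).toSchwartz : Space d → ℂ) = _
    rw [h, fourierInt_shift]
    rfl

theorem norm_componentPhase (i : (Ioi (0 : ℝ) × ℕ) ⊕ (Ioi (0 : ℝ) × ℕ))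
    (w : Space d × Space d) : ‖componentPhase i w‖ = 1 := by
  rcases i with i | i
  · exact norm_one
  · exact norm_character _ _

theorem pairWeight_componentShift (i : (Ioi (0 : ℝ) × ℕ) ⊕ (Ioi (0 : ℝ) × ℕ))
    (w : Space d × Space d) :
    ω ‖(componentShift i w).1‖ + ω ‖(componentShift i w).2‖ = pairWeight ω w := by
  rcases i with i | i
  · exact add_comm _ _
  · simp [componentShift, pairWeight]

theorem contDiff_component_shift (i : (Ioi (0 : ℝ) × ℕ) ⊕ (Ioi (0 : ℝ) × ℕ))
    (χ : OmegaSchwartz ω d) :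
    ContDiff ℝ (⊤ : ℕ∞) (Function.uncurry fun w => (shift w χ).component i) := by
  have h : (Function.uncurry fun w => (shift w χ).component i) = fun p =>
      componentPhase i p.1 * (character (componentShift i p.1).1 p.2 *
        χ.component i (p.2 - (componentShift i p.1).2)) := by
    ext p
    rw [Function.uncurry, component_shift]
    rfl
  rw [h]
  have h1 : ContDiff ℝ (⊤ : ℕ∞) fun w : Space d × Space d => componentPhase i w := by
    rcases i with i | i
    · exact contDiff_const
    · exact contDiff_character_uncurry.comp (contDiff_snd.prodMk contDiff_fst)
  have h2 : ContDiff ℝ (⊤ : ℕ∞) fun w : Space d × Space d => componentShift i w := by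
    rcases i with i | i
    · exact contDiff_snd.prodMk contDiff_fst
    · exact contDiff_fst.neg.prodMk contDiff_snd
  refine (h1.comp contDiff_fst).mul (ContDiff.mul ?_ ?_)
  · exact contDiff_character_uncurry.comp
      ((contDiff_fst.comp (h2.comp contDiff_fst)).prodMk contDiff_snd)
  · exact (χ.contDiff_component i).comp
      (contDiff_snd.sub (contDiff_snd.comp (h2.comp contDiff_fst)))

theorem component_shift_bound (i : (Ioi (0 : ℝ) × ℕ) ⊕ (Ioi (0 : ℝ) × ℕ))
    (χ : OmegaSchwartz ω d) {lam : ℝ} (hl : 0 < lam) (n : ℕ) :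
    ∃ C : ℝ, 0 ≤ C ∧ ∀ w y, Real.exp (lam * ω ‖y‖) *
      ‖iteratedFDeriv ℝ n ((shift w χ).component i) y‖ ≤
        C * Real.exp ((lam + n) * pairWeight ω w) := by
  obtain ⟨C, hC, h⟩ := character_mul_shift_bound (χ.contDiff_component i)
    (χ.hasOmegaDecay_component i) hl n
  refine ⟨C, hC, fun w y => ?_⟩
  have hs : ContDiff ℝ (⊤ : ℕ∞) fun y =>
      character (componentShift i w).1 y * χ.component i (y - (componentShift i w).2) :=
    (contDiff_character _).mul ((χ.contDiff_component i).comp (contDiff_id.sub contDiff_const))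
  rw [component_shift, iteratedFDeriv_const_smul_apply
    (hs.of_le (by exact_mod_cast le_top)).contDiffAt, norm_smul, norm_componentPhase, one_mul,
    ← pairWeight_componentShift i w]
  exact h _ _ y

/-- `w ↦ ⟨u, Π(w) χ⟩` grows at most exponentially in the weight. -/
theorem OmegaDistribution.shift_growth (u : OmegaDistribution ω d) (χ : OmegaSchwartz ω d) :
    ∃ C m : ℝ, 0 ≤ C ∧ 0 ≤ m ∧ ∀ w, ‖u (shift w χ)‖ ≤ C * Real.exp (m * pairWeight ω w) := by
  obtain ⟨s, C, hC, hu⟩ := u.exists_bound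
  choose A hA h using fun i : (Ioi (0 : ℝ) × ℕ) ⊕ (Ioi (0 : ℝ) × ℕ) =>
    component_shift_bound i χ (seminormParam i).1.2 (seminormParam i).2
  have hm : ∀ i, 0 ≤ ((seminormParam i).1 + (seminormParam i).2 : ℝ) := fun i =>
    add_nonneg (le_of_lt (seminormParam i).1.2) (Nat.cast_nonneg _)
  refine ⟨C * ∑ i ∈ s, A i, ∑ i ∈ s, ((seminormParam i).1 + (seminormParam i).2 : ℝ),
    mul_nonneg hC (Finset.sum_nonneg fun i _ => hA i), Finset.sum_nonneg fun i _ => hm i,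
    fun w => ?_⟩
  refine (hu _).trans ?_
  rw [mul_assoc]
  have hsum : 0 ≤ ∑ i ∈ s, A i := Finset.sum_nonneg fun i _ => hA i
  gcongr
  refine Seminorm.finset_sup_apply_le (by positivity) fun i hi => ?_
  rw [omegaSeminormFamily_apply]
  refine ciSup_le fun y => (h i w y).trans ?_
  have h0 := pairWeight_nonneg (ω := ω) w
  gcongr
  · exact Finset.single_le_sum (fun i _ => hA i) hi
  · exact Finset.single_le_sum (f := fun i => ((seminormParam i).1 + (seminormParam i).2 : ℝ))
      (fun i _ => hm i) hi

theorem isDominatedFamily_shift (i : (Ioi (0 : ℝ) × ℕ) ⊕ (Ioi (0 : ℝ) × ℕ))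
    (χ : OmegaSchwartz ω d) {c : Space d × Space d → ℂ} (hc : Continuous c)
    (hb : ∀ lam : ℝ, 0 < lam → ∃ C : ℝ, 0 ≤ C ∧ ∀ w, ‖c w‖ ≤ C * Real.exp (-(lam * pairWeight ω w))) :
    IsDominatedFamily ω volume c fun w => (shift w χ).component i := by
  intro lam hl n
  obtain ⟨A, hA, h⟩ := component_shift_bound i χ hl n
  obtain ⟨k, hk, hint⟩ := exists_integrable_exp_neg_pairWeight ω d
  -- The rate lam + n cancels the growth of the shifted window; k remains for integrability.
  obtain ⟨C, hC, hcb⟩ := hb (lam + n + k) (by positivity)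
  have hcont := continuous_pairWeight (ω := ω) (d := d)
  have hM : Continuous fun w : Space d × Space d => A * Real.exp ((lam + n) * pairWeight ω w) := by
    fun_prop
  refine ⟨_, hM, h, (hint.const_mul (C * A)).mono' (hc.norm.mul hM).aestronglyMeasurable
    (Eventually.of_forall fun w => ?_)⟩
  rw [norm_mul, norm_norm, Real.norm_of_nonneg (by positivity)]
  calc _ ≤ C * Real.exp (-((lam + n + k) * pairWeight ω w)) *
        (A * Real.exp ((lam + n) * pairWeight ω w)) := by gcongr; exact hcb w
    _ = C * A * (Real.exp (-((lam + n + k) * pairWeight ω w)) *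
        Real.exp ((lam + n) * pairWeight ω w)) := by ring
    _ = _ := by rw [← Real.exp_add]; ring_nf

/-! ### The Fourier transform in the normalization of `fourierInt` -/

/-- Source of the factor (2π)^d: the passage between the kernels e^{-i⟨x, ξ⟩} and e^{-2πi⟨x, ξ⟩}. -/
theorem integral_comp_inv_two_pi_smul {F : Type*} [NormedAddCommGroup F] [NormedSpace ℝ F]
    (G : Space d → F) :
    ∫ ξ : Space d, G ((2 * Real.pi)⁻¹ • ξ) = ((2 * Real.pi) ^ d) • ∫ ξ, G ξ := by
  rw [Measure.integral_comp_smul, finrank_euclideanSpace, Fintype.card_fin, inv_pow, inv_inv,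
    abs_of_pos (by positivity)]

theorem fourierInt_parseval (f g : 𝓢(Space d, ℂ)) :
    ∫ ξ, fourierInt f ξ * (starRingEnd ℂ) (fourierInt g ξ) =
      ((2 * Real.pi) ^ d : ℝ) • ∫ y, f y * (starRingEnd ℂ) (g y) := by
  have h := SchwartzMap.integral_inner_fourier_fourier g f
  simp only [RCLike.inner_apply] at h
  rw [← h, ← integral_comp_inv_two_pi_smul]
  refine integral_congr_ae (Eventually.of_forall fun ξ => ?_)
  simp only [fourierInt_eq, SchwartzMap.fourier_coe]

theorem integral_fourierInt_mul_character {h : Space d → ℂ} (hc : Continuous h) (hi : Integrable h)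
    (hF : Integrable (fourierInt h)) (t : Space d) :
    ∫ ξ, fourierInt h ξ * character ξ t = ((2 * Real.pi) ^ d : ℝ) • h t := by
  have h0 : fourierInt h = fun ξ => 𝓕 h ((2 * Real.pi)⁻¹ • ξ) := funext (fourierInt_eq h)
  have hF' : Integrable (𝓕 h) := by
    rw [h0] at hF
    exact (integrable_comp_smul_iff volume (𝓕 h) (by positivity)).1 hF
  have hinv := congrFun (hc.fourierInv_fourier_eq hi hF') t
  rw [Real.fourierInv_eq'] at hinv
  conv_rhs => rw [← hinv]
  rw [← integral_comp_inv_two_pi_smul]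
  refine integral_congr_ae (Eventually.of_forall fun ξ => ?_)
  dsimp only
  rw [h0, character, smul_eq_mul, mul_comm, inner_smul_left, real_inner_comm]
  congr 2
  have : (Real.pi : ℂ) ≠ 0 := by exact_mod_cast Real.pi_ne_zero
  simp only [RCLike.conj_to_real]
  push_cast
  field_simp

/-! ### Coefficients of phase-space shifts -/

theorem HasOmegaDecay.exists_norm_le {f : Space d → ℂ} (hf : HasOmegaDecay ω f) {lam : ℝ}
    (hl : 0 < lam) : ∃ C : ℝ, 0 ≤ C ∧ ∀ y, ‖f y‖ ≤ C * Real.exp (-(lam * ω ‖y‖)) := by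
  obtain ⟨C, hC⟩ := hf lam hl 0
  refine ⟨C, le_trans (by positivity) (hC ⟨0, rfl⟩), fun y => ?_⟩
  have h := hC ⟨y, rfl⟩
  dsimp only at h
  rw [norm_iteratedFDeriv_zero] at h
  rw [Real.exp_neg, ← div_eq_mul_inv, le_div_iff₀ (Real.exp_pos _), mul_comm]
  exact h

/-- Convolution-type estimate: ω(x) ≤ ω(y) + ω(y - x) shares the rate lam between the factors, and
the surplus k makes the integral converge. Only the modulus of the integrand matters, so characters
and phases play no role. -/
theorem HasOmegaDecay.norm_integral_le {f g : Space d → ℂ} (hf : HasOmegaDecay ω f)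
    (hg : HasOmegaDecay ω g) {lam : ℝ} (hl : 0 < lam) :
    ∃ C : ℝ, 0 ≤ C ∧ ∀ (x : Space d) (h : Space d → ℂ), (∀ y, ‖h y‖ = ‖f y‖ * ‖g (y - x)‖) →
      ‖∫ y, h y‖ ≤ C * Real.exp (-(lam * ω ‖x‖)) := by
  obtain ⟨k, hk, hint⟩ := ω.exists_integrable_exp_neg d
  obtain ⟨A, hA, hfA⟩ := hf.exists_norm_le (lam := lam + k) (by positivity)
  obtain ⟨B, hB, hgB⟩ := hg.exists_norm_le hl
  refine ⟨A * B * ∫ y : Space d, Real.exp (-(k * ω ‖y‖)), mul_nonneg (by positivity)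
    (integral_nonneg fun y => (Real.exp_pos _).le), fun x h hh => ?_⟩
  rw [mul_right_comm, ← integral_const_mul]
  refine norm_integral_le_of_norm_le (hint.const_mul _) (Eventually.of_forall fun y => ?_)
  have h3 : ω ‖x‖ ≤ ω ‖y‖ + ω ‖y - x‖ := by
    refine ω.norm_le_add ?_
    simpa using norm_sub_le y (y - x)
  rw [hh]
  calc _ ≤ (A * Real.exp (-((lam + k) * ω ‖y‖))) * (B * Real.exp (-(lam * ω ‖y - x‖))) := by
        gcongr
        · exact hfA y
        · exact hgB _
    _ = A * B * Real.exp (-((lam + k) * ω ‖y‖) + -(lam * ω ‖y - x‖)) := by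
      rw [Real.exp_add]; ring
    _ ≤ A * B * Real.exp (-(lam * ω ‖x‖) + -(k * ω ‖y‖)) := by
      refine mul_le_mul_of_nonneg_left (Real.exp_le_exp.2 ?_) (mul_nonneg hA hB)
      nlinarith [mul_le_mul_of_nonneg_left h3 hl.le]
    _ = _ := by rw [Real.exp_add]; ring

/-- The inner product of `f` with the phase-space shift of the window `χ`. -/
def coeff (χ f : OmegaSchwartz ω d) (w : Space d × Space d) : ℂ :=
  ∫ y, f.toSchwartz y * (starRingEnd ℂ) ((shift w χ).toSchwartz y)

theorem norm_coeff_le_component (χ f : OmegaSchwartz ω d)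
    (i : (Ioi (0 : ℝ) × ℕ) ⊕ (Ioi (0 : ℝ) × ℕ)) {lam : ℝ} (hl : 0 < lam) :
    ∃ C : ℝ, 0 ≤ C ∧ ∀ w, ‖∫ y, f.component i y * (starRingEnd ℂ) ((shift w χ).component i y)‖ ≤
      C * Real.exp (-(lam * ω ‖(componentShift i w).2‖)) := by
  obtain ⟨C, hC, h⟩ := (f.hasOmegaDecay_component i).norm_integral_le
    (χ.hasOmegaDecay_component i) hl
  refine ⟨C, hC, fun w => h _ _ fun y => ?_⟩
  rw [norm_mul, RCLike.norm_conj, component_shift, Pi.smul_apply, norm_smul, norm_mul,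
    norm_componentPhase, norm_character, one_mul, one_mul]

/-- The convolution estimate gives decay in x directly, and decay in ξ after Parseval. The geometric
mean of the two bounds decays in both variables, at half the rate; hence the doubled rate at the
start. -/
theorem norm_coeff_le (χ f : OmegaSchwartz ω d) {lam : ℝ} (hl : 0 < lam) :
    ∃ C : ℝ, 0 ≤ C ∧ ∀ w, ‖coeff χ f w‖ ≤ C * Real.exp (-(lam * pairWeight ω w)) := by
  have hl2 : 0 < 2 * lam := by positivity
  -- The parameters (1, 0) are dummies: a component depends only on the side of the sum to which the
  -- index belongs.
  obtain ⟨A, hA, h1⟩ := norm_coeff_le_component χ f (Sum.inl (⟨1, mem_Ioi.2 one_pos⟩, 0)) hl2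
  obtain ⟨B, hB, h2⟩ := norm_coeff_le_component χ f (Sum.inr (⟨1, mem_Ioi.2 one_pos⟩, 0)) hl2
  refine ⟨A + B, by positivity, fun w => ?_⟩
  have ha : ‖coeff χ f w‖ ≤ A * Real.exp (-(2 * lam * ω ‖w.1‖)) := h1 w
  have hb : ‖coeff χ f w‖ ≤ B * Real.exp (-(2 * lam * ω ‖w.2‖)) := by
    refine le_trans ?_ (h2 w)
    have h := fourierInt_parseval f.toSchwartz (shift w χ).toSchwartz
    change _ ≤ ‖∫ ξ, fourierInt f.toSchwartz ξ *
      (starRingEnd ℂ) (fourierInt (shift w χ).toSchwartz ξ)‖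
    rw [h, norm_smul]
    refine le_mul_of_one_le_left (norm_nonneg _) ?_
    rw [Real.norm_of_nonneg (by positivity)]
    exact one_le_pow₀ (by linarith [Real.pi_gt_three])
  refine le_of_sq_le_sq ?_ (by positivity)
  calc ‖coeff χ f w‖ ^ 2 = ‖coeff χ f w‖ * ‖coeff χ f w‖ := sq _
    _ ≤ (A * Real.exp (-(2 * lam * ω ‖w.1‖))) * (B * Real.exp (-(2 * lam * ω ‖w.2‖))) := by gcongr
    _ = A * B * Real.exp (-(lam * pairWeight ω w)) ^ 2 := by
      rw [mul_mul_mul_comm, ← Real.exp_add, ← Real.exp_nat_mul, pairWeight]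
      push_cast
      ring_nf
    _ ≤ (A + B) ^ 2 * Real.exp (-(lam * pairWeight ω w)) ^ 2 := by
      gcongr
      nlinarith
    _ = _ := by ring

theorem continuous_shift_apply (χ : OmegaSchwartz ω d) (y : Space d) :
    Continuous fun w => (shift w χ).toSchwartz y := by
  simp only [shift_apply]
  refine (contDiff_character_uncurry.continuous.comp
    (continuous_snd.prodMk continuous_const)).mul ?_
  exact χ.toSchwartz.continuous.comp (continuous_const.sub continuous_fst)

theorem continuous_coeff (χ f : OmegaSchwartz ω d) : Continuous (coeff χ f) := by
  obtain ⟨B, hB, hχ⟩ := χ.hasOmegaDecay.exists_norm_le one_pos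
  have hf := f.toSchwartz.continuous
  refine continuous_of_dominated (bound := fun y => ‖f.toSchwartz y‖ * B) (fun w => ?_)
    (fun w => Eventually.of_forall fun y => ?_)
    (f.toSchwartz.integrable.norm.mul_const _) (Eventually.of_forall fun y => ?_)
  · have h := (shift w χ).toSchwartz.continuous
    exact (hf.mul (Complex.continuous_conj.comp h)).aestronglyMeasurable
  · rw [norm_mul, RCLike.norm_conj, shift_apply, norm_mul, norm_character, one_mul]
    gcongr
    refine (hχ _).trans (mul_le_of_le_one_right hB (Real.exp_le_one_iff.2 ?_))
    linarith [ω.norm_nonneg (y - w.1)]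
  · exact continuous_const.mul (Complex.continuous_conj.comp (continuous_shift_apply χ y))

/-- Covariance: phase-space shifts compose up to a unimodular factor, obtained here by translating
the integration variable by the first component of `z`. -/
theorem norm_coeff_shift (χ χ' : OmegaSchwartz ω d) (z w : Space d × Space d) :
    ‖coeff χ (shift z χ') w‖ = ‖coeff χ χ' (w - z)‖ := by
  have h : coeff χ (shift z χ') w = character (z.2 - w.2) z.1 * coeff χ χ' (w - z) := by
    rw [coeff, coeff, ← integral_const_mul, ← integral_add_right_eq_self _ z.1]
    refine integral_congr_ae (Eventually.of_forall fun y => ?_)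
    simp only [shift_apply, map_mul, add_sub_cancel_right, Prod.fst_sub, Prod.snd_sub]
    have h1 : y + z.1 - w.1 = y - (w.1 - z.1) := by abel
    have h2 : character z.2 (y + z.1) * (starRingEnd ℂ) (character w.2 (y + z.1)) =
        character (z.2 - w.2) z.1 * (starRingEnd ℂ) (character (w.2 - z.2) y) := by
      simp only [character, ← Complex.exp_conj, ← Complex.exp_add, map_mul, Complex.conj_I,
        Complex.conj_ofReal, inner_add_left, inner_sub_right]
      congr 1
      push_cast
      ring
    rw [h1]
    linear_combination (χ'.toSchwartz y * (starRingEnd ℂ) (χ.toSchwartz (y - (w.1 - z.1)))) * h2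
  rw [h, norm_mul, norm_character, one_mul]

/-! ### The inversion formula -/

/-- Joint integrability, which justifies Fubini when the inversion formula is carried over to
Fourier transforms. -/
theorem integrable_coeff_mul (χ f : OmegaSchwartz ω d)
    (i : (Ioi (0 : ℝ) × ℕ) ⊕ (Ioi (0 : ℝ) × ℕ)) :
    Integrable (fun p : Space d × (Space d × Space d) =>
      coeff χ f p.2 * (shift p.2 χ).component i p.1) (volume.prod volume) := by
  obtain ⟨k, hk, hint⟩ := ω.exists_integrable_exp_neg d
  obtain ⟨l, hl, hint'⟩ := exists_integrable_exp_neg_pairWeight ω d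
  obtain ⟨A, hA, hs⟩ := component_shift_bound i χ hk 0
  obtain ⟨C, hC, hc⟩ := norm_coeff_le χ f (lam := k + l) (by positivity)
  refine ((hint.mul_prod hint').const_mul (C * A)).mono' ?_ (Eventually.of_forall fun p => ?_)
  · have h := (contDiff_component_shift i χ).continuous
    exact (((continuous_coeff χ f).comp continuous_snd).mul
      (h.comp (continuous_snd.prodMk continuous_fst))).aestronglyMeasurable
  · have h1 := hs p.2 p.1
    rw [norm_iteratedFDeriv_zero, Nat.cast_zero, add_zero] at h1
    have h2 : ‖(shift p.2 χ).component i p.1‖ ≤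
        A * Real.exp (k * pairWeight ω p.2) * Real.exp (-(k * ω ‖p.1‖)) := by
      rw [Real.exp_neg, ← div_eq_mul_inv, le_div_iff₀ (Real.exp_pos _), mul_comm]
      exact h1
    rw [norm_mul]
    calc _ ≤ C * Real.exp (-((k + l) * pairWeight ω p.2)) *
          (A * Real.exp (k * pairWeight ω p.2) * Real.exp (-(k * ω ‖p.1‖))) := by
          gcongr
          exact hc p.2
      _ = C * A * (Real.exp (-(k * ω ‖p.1‖)) * (Real.exp (-((k + l) * pairWeight ω p.2)) *
          Real.exp (k * pairWeight ω p.2))) := by ring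
      _ = _ := by rw [← Real.exp_add]; ring_nf

/-- The constant in the inversion formula. -/
def inversionConst (χ : OmegaSchwartz ω d) : ℝ :=
  (2 * Real.pi) ^ d * ∫ y, ‖χ.toSchwartz y‖ ^ 2

theorem integral_norm_sq_pos {χ : OmegaSchwartz ω d} (hχ : χ ≠ 0) :
    0 < ∫ y, ‖χ.toSchwartz y‖ ^ 2 := by
  obtain ⟨C, hC, hb⟩ := χ.hasOmegaDecay.exists_norm_le one_pos
  have hcont := χ.toSchwartz.continuous
  have hint : Integrable fun y => ‖χ.toSchwartz y‖ ^ 2 := by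
    refine (χ.toSchwartz.integrable.norm.const_mul C).mono'
      (by fun_prop : Continuous _).aestronglyMeasurable (Eventually.of_forall fun y => ?_)
    rw [Real.norm_of_nonneg (by positivity), sq]
    gcongr
    refine (hb y).trans (mul_le_of_le_one_right hC (Real.exp_le_one_iff.2 ?_))
    linarith [ω.norm_nonneg y]
  rw [integral_pos_iff_support_of_nonneg (fun y => by positivity) hint]
  have hopen : IsOpen (Function.support fun y => ‖χ.toSchwartz y‖ ^ 2) :=
    (by fun_prop : Continuous fun y => ‖χ.toSchwartz y‖ ^ 2).isOpen_support
  refine hopen.measure_pos volume ?_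
  by_contra hne
  rw [Set.not_nonempty_iff_eq_empty, Function.support_eq_empty_iff] at hne
  refine hχ (Subtype.ext (SchwartzMap.ext fun y => ?_))
  have h := congrFun hne y
  have h0 : χ.toSchwartz y = 0 := by simpa using h
  exact h0

theorem inversionConst_pos {χ : OmegaSchwartz ω d} (hχ : χ ≠ 0) : 0 < inversionConst χ :=
  mul_pos (by positivity) (integral_norm_sq_pos hχ)

/-- For fixed x the coefficient is, as a function of ξ, the Fourier transform of f · conj χ(· - x).
Fourier inversion in ξ gives (2π)^d f(t) |χ(t - x)|², and integration in x leaves the square of the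
L² norm of χ. -/
theorem integral_coeff_mul_shift (χ f : OmegaSchwartz ω d) (t : Space d) :
    ∫ w, coeff χ f w * (shift w χ).toSchwartz t = inversionConst χ * f.toSchwartz t := by
  obtain ⟨l, hl, hint'⟩ := exists_integrable_exp_neg_pairWeight ω d
  obtain ⟨k, hk, hint⟩ := ω.exists_integrable_exp_neg d
  obtain ⟨B, hB, hχ⟩ := χ.hasOmegaDecay.exists_norm_le one_pos
  have hχB : ∀ y, ‖χ.toSchwartz y‖ ≤ B := fun y => (hχ y).trans
    (mul_le_of_le_one_right hB (Real.exp_le_one_iff.2 (by linarith [ω.norm_nonneg y])))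
  have hfc := f.toSchwartz.continuous
  have hχc := χ.toSchwartz.continuous
  have hI : Integrable (fun w => coeff χ f w * (shift w χ).toSchwartz t)
      (volume.prod volume) := by
    obtain ⟨C, hC, hc⟩ := norm_coeff_le χ f hl
    refine (hint'.const_mul (C * B)).mono' ((continuous_coeff χ f).mul
      (continuous_shift_apply χ t)).aestronglyMeasurable
      (Eventually.of_forall fun w => ?_)
    rw [norm_mul, shift_apply, norm_mul, norm_character, one_mul, mul_right_comm]
    gcongr
    · exact hc w
    · exact hχB _
  rw [Measure.volume_eq_prod, integral_prod _ hI]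
  have hinner : ∀ x, ∫ ξ, coeff χ f (x, ξ) * (shift (x, ξ) χ).toSchwartz t =
      (((2 * Real.pi) ^ d : ℝ) * f.toSchwartz t) * ((‖χ.toSchwartz (t - x)‖ ^ 2 : ℝ) : ℂ) := by
    intro x
    let h : Space d → ℂ := fun y => f.toSchwartz y * (starRingEnd ℂ) (χ.toSchwartz (y - x))
    have hc : Continuous h := by fun_prop
    have hi : Integrable h := by
      refine (f.toSchwartz.integrable.norm.mul_const B).mono' hc.aestronglyMeasurable
        (Eventually.of_forall fun y => ?_)
      rw [norm_mul, RCLike.norm_conj]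
      gcongr
      exact hχB _
    have hcoeff : ∀ ξ, coeff χ f (x, ξ) = fourierInt h ξ := by
      intro ξ
      refine integral_congr_ae (Eventually.of_forall fun y => ?_)
      simp only [shift_apply, map_mul, h, character, ← Complex.exp_conj, Complex.conj_I,
        Complex.conj_ofReal, neg_mul]
      ring
    have hF : Integrable (fourierInt h) := by
      obtain ⟨C, hC, hcb⟩ := norm_coeff_le χ f hk
      have hcont : Continuous (fourierInt h) := by
        rw [← funext hcoeff]
        exact (continuous_coeff χ f).comp (Continuous.prodMk_right x)
      refine (hint.const_mul C).mono' hcont.aestronglyMeasurable (Eventually.of_forall fun ξ => ?_)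
      rw [← hcoeff]
      refine (hcb _).trans ?_
      gcongr
      exact le_add_of_nonneg_left (ω.norm_nonneg x)
    have h1 := integral_fourierInt_mul_character hc hi hF t
    have h2 : ∀ ξ, coeff χ f (x, ξ) * (shift (x, ξ) χ).toSchwartz t =
        fourierInt h ξ * character ξ t * χ.toSchwartz (t - x) := fun ξ => by
      rw [hcoeff, shift_apply, mul_assoc]
    simp only [h2]
    rw [integral_mul_const, h1, Complex.real_smul]
    simp only [h]
    rw [mul_assoc, mul_assoc, mul_assoc, mul_comm ((starRingEnd ℂ) _), RCLike.mul_conj]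
    push_cast
    rfl
  simp only [hinner]
  rw [integral_const_mul, integral_complex_ofReal,
    integral_sub_left_eq_self (fun y => ‖χ.toSchwartz y‖ ^ 2) volume t, inversionConst]
  push_cast
  ring

/-- The Fourier side follows from the pointwise formula by exchanging the integrals over y and w. -/
theorem integral_coeff_mul_component (χ f : OmegaSchwartz ω d)
    (i : (Ioi (0 : ℝ) × ℕ) ⊕ (Ioi (0 : ℝ) × ℕ)) (t : Space d) :
    ∫ w, coeff χ f w * (shift w χ).component i t = inversionConst χ * f.component i t := by
  rcases i with i | i
  · exact integral_coeff_mul_shift χ f t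
  · change ∫ w, coeff χ f w * fourierInt (shift w χ).toSchwartz t =
      inversionConst χ * fourierInt f.toSchwartz t
    simp only [fourierInt]
    rw [← integral_const_mul]
    have h1 : ∀ y, (inversionConst χ : ℂ) *
        (Complex.exp (-(Complex.I * (inner ℝ y t : ℝ))) * f.toSchwartz y) =
        ∫ w, Complex.exp (-(Complex.I * (inner ℝ y t : ℝ))) *
          (coeff χ f w * (shift w χ).toSchwartz y) := by
      intro y
      rw [integral_const_mul, integral_coeff_mul_shift]
      ring
    simp only [h1]
    rw [integral_integral_swap]
    · refine integral_congr_ae (Eventually.of_forall fun w => ?_)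
      dsimp only
      rw [← integral_const_mul]
      refine integral_congr_ae (Eventually.of_forall fun y => ?_)
      dsimp only
      ring
    · refine (integrable_coeff_mul χ f (Sum.inl i)).bdd_mul (c := 1) ?_ ?_
      · exact Continuous.aestronglyMeasurable (by fun_prop)
      · exact Eventually.of_forall fun p => by simp [Complex.norm_exp]

/-! ### Change of window -/

theorem OmegaSchwartz.conj_ne_zero {φ : OmegaSchwartz ω d} (h : φ ≠ 0) : φ.conj ≠ 0 := by
  intro h0
  refine h (Subtype.ext (SchwartzMap.ext fun y => ?_))
  have h1 : (starRingEnd ℂ) (φ.toSchwartz y) = 0 := by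
    rw [← OmegaSchwartz.conj_apply, h0]
    simp
  have h2 : φ.toSchwartz y = 0 := by simpa using h1
  exact h2

/-- The reflection `(x, ξ) ↦ (x, -ξ)`. -/
def reflect (w : Space d × Space d) : PhaseSpace d := WithLp.toLp 2 (w.1, -w.2)

theorem reflect_sub (w z : Space d × Space d) : reflect (w - z) = reflect w - reflect z := by
  simp only [reflect, ← WithLp.toLp_sub, Prod.mk_sub_mk, Prod.fst_sub, Prod.snd_sub, neg_sub_neg,
    neg_sub]

theorem exists_reflect_eq (z : PhaseSpace d) : ∃ w, reflect w = z :=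
  ⟨(z.fst, -z.snd), by rw [reflect, neg_neg]; rfl⟩

theorem weight_reflect_le (w : Space d × Space d) : ω ‖reflect w‖ ≤ pairWeight ω w := by
  simpa [pairWeight, reflect] using weight_toLp_le (ω := ω) (w.1, -w.2)

theorem pairWeight_le_reflect (w : Space d × Space d) : pairWeight ω w ≤ 2 * ω ‖reflect w‖ := by
  simpa [pairWeight, reflect] using pairWeight_le (ω := ω) (w.1, -w.2)

/-- Conjugating a shifted window conjugates the window and flips the frequency. This replaces the
conjugate linear pairing by u itself, which is linear. -/
theorem stft_reflect (φ : OmegaSchwartz ω d) (u : OmegaDistribution ω d)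
    (w : Space d × Space d) : stft φ u (reflect w) = u (shift w φ.conj) := by
  rw [stft, pairing]
  congr 1
  refine Subtype.ext (SchwartzMap.ext fun y => ?_)
  change (phaseShift (reflect w) φ).conj.toSchwartz y = (shift w φ.conj).toSchwartz y
  rw [OmegaSchwartz.conj_apply, phaseShift_apply, shift_apply, OmegaSchwartz.conj_apply, map_mul,
    ← Complex.exp_conj, character]
  congr 2
  simp [reflect]

theorem norm_shift_le_integral (u : OmegaDistribution ω d) {χ : OmegaSchwartz ω d} (hχ : χ ≠ 0)
    (χ' : OmegaSchwartz ω d) (z : Space d × Space d) :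
    ‖u (shift z χ')‖ ≤
      (inversionConst χ)⁻¹ * ∫ w, ‖coeff χ χ' (w - z)‖ * ‖u (shift w χ)‖ := by
  have hK := inversionConst_pos hχ
  have hK' : (inversionConst χ : ℂ) ≠ 0 := by exact_mod_cast hK.ne'
  have hc : Continuous fun w => (inversionConst χ : ℂ)⁻¹ * coeff χ (shift z χ') w :=
    continuous_const.mul (continuous_coeff _ _)
  have h : u (shift z χ') =
      ∫ w, ((inversionConst χ : ℂ)⁻¹ * coeff χ (shift z χ') w) * u (shift w χ) := by
    refine u.map_integral hc (fun i => contDiff_component_shift i χ)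
      (fun i => isDominatedFamily_shift i χ hc fun lam hl => ?_) fun i x => ?_
    · obtain ⟨C, hC, hb⟩ := norm_coeff_le χ (shift z χ') hl
      refine ⟨(inversionConst χ)⁻¹ * C, by positivity, fun w => ?_⟩
      rw [norm_mul, norm_inv, Complex.norm_real, Real.norm_of_nonneg hK.le, mul_assoc]
      gcongr
      exact hb w
    · simp only [mul_assoc]
      rw [integral_const_mul, integral_coeff_mul_component, inv_mul_cancel_left₀ hK']
  rw [h, ← integral_const_mul]
  refine (norm_integral_le_integral_norm _).trans_eq ?_
  refine integral_congr_ae (Eventually.of_forall fun w => ?_)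
  dsimp only
  rw [norm_mul, norm_mul, norm_coeff_shift, norm_inv, Complex.norm_real, Real.norm_of_nonneg hK.le,
    mul_assoc]

theorem pairWeight_le_add (w z : Space d × Space d) :
    pairWeight ω w ≤ pairWeight ω z + pairWeight ω (w - z) := by
  have h1 : ω ‖w.1‖ ≤ ω ‖z.1‖ + ω ‖w.1 - z.1‖ :=
    ω.norm_le_add (by simpa using norm_add_le z.1 (w.1 - z.1))
  have h2 : ω ‖w.2‖ ≤ ω ‖z.2‖ + ω ‖w.2 - z.2‖ :=
    ω.norm_le_add (by simpa using norm_add_le z.2 (w.2 - z.2))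
  simp only [pairWeight, Prod.fst_sub, Prod.snd_sub]
  linarith

/-- A uniform cone neighbourhood: points whose distance to `Γ'` is relatively small lie in `Γ`. -/
theorem IsOpenConic.exists_relative_distance {Γ Γ' : Set (PhaseSpace d)} (hΓ : IsOpenConic Γ)
    (hΓ' : IsOpenConic Γ') (h : closure (Γ' ∩ Metric.sphere 0 1) ⊆ Γ) :
    ∃ δ : ℝ, 0 < δ ∧ ∀ z ∈ Γ', ∀ w, ‖w - z‖ < δ * ‖z‖ → w ∈ Γ := by
  -- The trace on the sphere has compact closure, so a single thickening radius works for it;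
  -- dilations carry it to all of `Γ'`.
  have hK : IsCompact (closure (Γ' ∩ Metric.sphere (0 : PhaseSpace d) 1)) :=
    (isCompact_sphere _ _).closure_of_subset inter_subset_right
  obtain ⟨δ, hδ, hsub⟩ := hK.exists_thickening_subset_open hΓ.isOpen h
  refine ⟨δ, hδ, fun z hz w hw => ?_⟩
  have hz0 : 0 < ‖z‖ := norm_pos_iff.2 fun h0 => hΓ'.zero_notMem (h0 ▸ hz)
  have hmem : ‖z‖⁻¹ • w ∈ Γ := by
    refine hsub (Metric.mem_thickening_iff.2 ⟨‖z‖⁻¹ • z, subset_closure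
      ⟨hΓ'.smul_mem z hz _ (inv_pos.2 hz0), ?_⟩, ?_⟩)
    · rw [mem_sphere_zero_iff_norm, norm_smul, norm_inv, norm_norm, inv_mul_cancel₀ hz0.ne']
    · rw [dist_eq_norm, ← smul_sub, norm_smul, norm_inv, norm_norm, inv_mul_lt_iff₀ hz0, mul_comm]
      exact hw
  simpa [smul_smul, hz0.ne'] using hΓ.smul_mem _ hmem ‖z‖ hz0

instance : (volume : Measure (Space d × Space d)).IsAddRightInvariant := by
  rw [Measure.volume_eq_prod]
  infer_instance

theorem StftDecaysOn.change_window {u : OmegaDistribution ω d} {φ : OmegaSchwartz ω d} (hφ : φ ≠ 0)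
    {Γ : Set (PhaseSpace d)} (hΓ : IsOpenConic Γ) (hdec : StftDecaysOn φ u Γ)
    (ψ : OmegaSchwartz ω d) {Γ' : Set (PhaseSpace d)} (hΓ' : IsOpenConic Γ')
    (hsub : closure (Γ' ∩ Metric.sphere 0 1) ⊆ Γ) : StftDecaysOn ψ u Γ' := by
  intro lam hl
  obtain ⟨δ, hδ, hcone⟩ := hΓ.exists_relative_distance hΓ' hsub
  obtain ⟨N, hN⟩ := exists_nat_ge (1 / δ)
  obtain ⟨C, m, hC, hm, hgrowth⟩ := u.shift_growth φ.conj
  obtain ⟨D, hD⟩ := hdec lam hl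
  obtain ⟨k, hk, hint⟩ := exists_integrable_exp_neg_pairWeight ω d
  -- For w far from z the exponent is lam ω(z) + m ω(w) with ω(w) ≤ 2ω(z) + ω(w - z) and ω(z) ≤ (N +
  -- 1) ω(w - z) in terms of the additive weight; `L` is the resulting coefficient of ω(w - z).
  set L : ℝ := (lam + 2 * m) * (N + 1) + m with hL
  have hLpos : 0 < L := by positivity
  have hlL : lam ≤ L := by
    have : 0 ≤ lam * N := by positivity
    nlinarith [mul_nonneg hm (Nat.cast_nonneg (α := ℝ) N)]
  obtain ⟨B, hB, hcoeff⟩ := norm_coeff_le φ.conj ψ.conj (lam := L + k) (by positivity)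
  have hK := inversionConst_pos (OmegaSchwartz.conj_ne_zero hφ)
  set I : ℝ := ∫ w : Space d × Space d, Real.exp (-(k * pairWeight ω w)) with hI
  refine ⟨(inversionConst φ.conj)⁻¹ * (B * (C + |D|) * I), ?_⟩
  rintro _ ⟨z', hz', rfl⟩
  obtain ⟨z, rfl⟩ := exists_reflect_eq z'
  dsimp only
  -- It suffices to bound u(Π(w)χ), weighted at z rather than at w, by e^{Lω(w - z)}; the kernel, of
  -- rate L + k, then leaves an integrable factor whose integral does not depend on z.
  have key : ∀ w, Real.exp (lam * ω ‖reflect z‖) * ‖u (shift w φ.conj)‖ ≤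
      (C + |D|) * Real.exp (L * pairWeight ω (w - z)) := by
    intro w
    have hp := pairWeight_nonneg (ω := ω) (w - z)
    by_cases hw : ‖reflect w - reflect z‖ < δ * ‖reflect z‖
    · have h1 := hD ⟨reflect w, hcone _ hz' _ hw, rfl⟩
      dsimp only at h1
      rw [stft_reflect] at h1
      have h2 : ω ‖reflect z‖ ≤ ω ‖reflect w‖ + pairWeight ω (w - z) := by
        have h3 := weight_reflect_le (ω := ω) (w - z)
        rw [reflect_sub] at h3
        refine le_trans (ω.norm_le_add ?_) (add_le_add le_rfl h3)
        simpa using norm_sub_le (reflect w) (reflect w - reflect z)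
      calc _ ≤ Real.exp (lam * (ω ‖reflect w‖ + pairWeight ω (w - z))) *
            ‖u (shift w φ.conj)‖ := by gcongr
        _ = Real.exp (lam * ω ‖reflect w‖) * ‖u (shift w φ.conj)‖ *
            Real.exp (lam * pairWeight ω (w - z)) := by rw [mul_add, Real.exp_add]; ring
        _ ≤ (C + |D|) * Real.exp (L * pairWeight ω (w - z)) := by
          gcongr
          linarith [le_abs_self D]
    -- Far from z nothing is known about u beyond its growth, but ω(z) is now controlled by ω(w -
    -- z).
    · have h1 : ‖reflect z‖ ≤ ((N + 1 : ℕ) : ℝ) * ‖reflect (w - z)‖ := by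
        rw [reflect_sub]
        have h2 := not_lt.1 hw
        have h3 : ‖reflect z‖ ≤ 1 / δ * ‖reflect w - reflect z‖ := by
          rw [one_div, ← div_eq_inv_mul, le_div_iff₀ hδ, mul_comm]
          exact h2
        refine h3.trans ?_
        gcongr
        push_cast
        linarith
      have h2 : ω ‖reflect z‖ ≤ (N + 1) * pairWeight ω (w - z) := by
        refine (ω.mono (norm_nonneg _) h1).trans ((ω.nat_mul_le N (norm_nonneg _)).trans ?_)
        push_cast
        gcongr
        exact weight_reflect_le _
      have h3 := pairWeight_le_add (ω := ω) w z
      have h4 := pairWeight_le_reflect (ω := ω) z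
      calc _ ≤ Real.exp (lam * ω ‖reflect z‖) * (C * Real.exp (m * pairWeight ω w)) := by
            gcongr
            exact hgrowth w
        _ = C * Real.exp (lam * ω ‖reflect z‖ + m * pairWeight ω w) := by
          rw [Real.exp_add]; ring
        _ ≤ C * Real.exp (L * pairWeight ω (w - z)) := by
          refine mul_le_mul_of_nonneg_left (Real.exp_le_exp.2 ?_) hC
          have h5 : m * pairWeight ω w ≤ m * (2 * ω ‖reflect z‖ + pairWeight ω (w - z)) :=
            mul_le_mul_of_nonneg_left (by linarith) hm
          have h6 : (lam + 2 * m) * ω ‖reflect z‖ ≤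
              (lam + 2 * m) * ((N + 1) * pairWeight ω (w - z)) :=
            mul_le_mul_of_nonneg_left h2 (by positivity)
          rw [hL]
          linarith
        _ ≤ _ := by
          gcongr
          linarith [abs_nonneg D]
  rw [stft_reflect]
  calc _ ≤ Real.exp (lam * ω ‖reflect z‖) * ((inversionConst φ.conj)⁻¹ *
        ∫ w, ‖coeff φ.conj ψ.conj (w - z)‖ * ‖u (shift w φ.conj)‖) := by
        gcongr
        exact norm_shift_le_integral u (OmegaSchwartz.conj_ne_zero hφ) _ z
    _ = (inversionConst φ.conj)⁻¹ * ∫ w, Real.exp (lam * ω ‖reflect z‖) *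
        (‖coeff φ.conj ψ.conj (w - z)‖ * ‖u (shift w φ.conj)‖) := by
      rw [integral_const_mul]; ring
    _ ≤ (inversionConst φ.conj)⁻¹ *
        ∫ w, B * (C + |D|) * Real.exp (-(k * pairWeight ω (w - z))) := by
      refine mul_le_mul_of_nonneg_left ?_ (inv_pos.2 hK).le
      refine integral_mono_of_nonneg (Eventually.of_forall fun w => by positivity)
        ((hint.comp_sub_right z).const_mul _) (Eventually.of_forall fun w => ?_)
      calc _ = ‖coeff φ.conj ψ.conj (w - z)‖ *
            (Real.exp (lam * ω ‖reflect z‖) * ‖u (shift w φ.conj)‖) := by ring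
        _ ≤ (B * Real.exp (-((L + k) * pairWeight ω (w - z)))) *
            ((C + |D|) * Real.exp (L * pairWeight ω (w - z))) := by
          exact mul_le_mul (hcoeff _) (key w) (by positivity) (by positivity)
        _ = B * (C + |D|) * (Real.exp (-((L + k) * pairWeight ω (w - z))) *
            Real.exp (L * pairWeight ω (w - z))) := by ring
        _ = _ := by
          rw [← Real.exp_add]
          ring_nf
    _ = _ := by
      rw [integral_const_mul,
        integral_sub_right_eq_self (fun w => Real.exp (-(k * pairWeight ω w))) z]

/-! ### The wave front set -/

theorem isOpen_normalized_mem {E : Type*} [NormedAddCommGroup E] [NormedSpace ℝ E] {U : Set E}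
    (hU : IsOpen U) : IsOpen {z : E | z ≠ 0 ∧ ‖z‖⁻¹ • z ∈ U} := by
  have hinv : ContinuousOn (fun z : E => ‖z‖⁻¹) {0}ᶜ :=
    continuous_norm.continuousOn.inv₀ fun z hz => norm_ne_zero_iff.2 hz
  exact (hinv.smul continuousOn_id).isOpen_inter_preimage isOpen_compl_singleton hU

/-- Every open conic set contains, around each of its points, a smaller one whose trace on the
sphere has closure in the given set. -/
theorem IsOpenConic.exists_smaller {Γ : Set (PhaseSpace d)} (hΓ : IsOpenConic Γ)
    {z₀ : PhaseSpace d} (hz₀ : z₀ ∈ Γ) : ∃ Γ' : Set (PhaseSpace d), IsOpenConic Γ' ∧ z₀ ∈ Γ' ∧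
      closure (Γ' ∩ Metric.sphere 0 1) ⊆ Γ := by
  have h0 : 0 < ‖z₀‖ := norm_pos_iff.2 fun h => hΓ.zero_notMem (h ▸ hz₀)
  have hmem : ‖z₀‖⁻¹ • z₀ ∈ Γ := hΓ.smul_mem _ hz₀ _ (inv_pos.2 h0)
  obtain ⟨r, hr, hball⟩ := Metric.nhds_basis_closedBall.mem_iff.1 (hΓ.isOpen.mem_nhds hmem)
  -- The cone over a ball about the normalized z₀. On the unit sphere normalization is the identity,
  -- so the trace lies in the closed ball, which is contained in `Γ`.
  refine ⟨{z | z ≠ 0 ∧ ‖z‖⁻¹ • z ∈ Metric.ball (‖z₀‖⁻¹ • z₀) r}, ⟨?_, fun h => h.1 rfl, ?_⟩,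
    ⟨norm_pos_iff.1 h0, Metric.mem_ball_self hr⟩, ?_⟩
  · exact isOpen_normalized_mem Metric.isOpen_ball
  · rintro z ⟨hz, hzb⟩ t ht
    refine ⟨smul_ne_zero ht.ne' hz, ?_⟩
    rw [norm_smul, Real.norm_of_nonneg ht.le, mul_inv_rev, smul_smul, mul_assoc,
      inv_mul_cancel₀ ht.ne', mul_one]
    exact hzb
  · refine (closure_minimal ?_ Metric.isClosed_closedBall).trans hball
    rintro z ⟨⟨-, hz⟩, hz1⟩
    rw [mem_sphere_zero_iff_norm] at hz1
    rw [hz1, inv_one, one_smul] at hz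
    exact Metric.ball_subset_closedBall hz

/-- If V_φ u decays on a cone around z₀, then V_ψ u decays on a smaller one, so z₀ is outside both
sets. Exchanging the windows gives equality. -/
theorem waveFrontSet_subset {φ ψ : OmegaSchwartz ω d} (hφ : φ ≠ 0) (u : OmegaDistribution ω d) :
    waveFrontSet ψ u ⊆ waveFrontSet φ u := by
  rintro z₀ ⟨h0, hz⟩
  refine ⟨h0, ?_⟩
  rintro ⟨Γ, hΓ, hmem, hdec⟩
  obtain ⟨Γ', hΓ', hmem', hsub⟩ := hΓ.exists_smaller hmem
  exact hz ⟨Γ', hΓ', hmem', hdec.change_window hφ hΓ ψ hΓ' hsub⟩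

end OmegaGabor

end

theorem mainTheorem3 (ω : OmegaGabor.WeightFunction) (d : ℕ) (u : OmegaGabor.OmegaDistribution ω d) :
    (∀ φ : OmegaGabor.OmegaSchwartz ω d, φ ≠ 0 →
      ∀ Γ : Set (OmegaGabor.PhaseSpace d), OmegaGabor.IsOpenConic Γ →
        OmegaGabor.StftDecaysOn φ u Γ →
      ∀ ψ : OmegaGabor.OmegaSchwartz ω d, ψ ≠ 0 →
      ∀ Γ' : Set (OmegaGabor.PhaseSpace d), OmegaGabor.IsOpenConic Γ' →
        closure (Γ' ∩ Metric.sphere 0 1) ⊆ Γ →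
        OmegaGabor.StftDecaysOn ψ u Γ') ∧
    (∀ φ ψ : OmegaGabor.OmegaSchwartz ω d, φ ≠ 0 → ψ ≠ 0 →
      OmegaGabor.waveFrontSet φ u = OmegaGabor.waveFrontSet ψ u) :=
  ⟨fun _ hφ _ hΓ hdec ψ _ _ hΓ' hsub => hdec.change_window hφ hΓ ψ hΓ' hsub,
    fun _ _ hφ hψ => (OmegaGabor.waveFrontSet_subset hψ u).antisymm
      (OmegaGabor.waveFrontSet_subset hφ u)⟩
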